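/- Let $X$ be a set and $\mathcal A_X=\{A_x\}_{x\in X}$ a family of unital C*-algebras; $\otimes$ denotes the completed spatial tensor product. An operator field is a map $f$ on $X$ with $f(x)\in A_x$; $\ell_\infty(\mathcal A_X)$ is the space of operator fields with $\|f\|_\infty=\sup_x\|f(x)\|<\infty$. A metric operator field (mof) is a family $D_{x,x'}\in A_x\otimes A_{x'}$ ($x,x'\in X$) such that (a) there are states $\mu_x$ of $A_x$ with $(\mu_x\otimes\mu_x)(D_{x,x})=0$ for all $x$; (b) $D_{x,x'}$ is positive and invertible for $x\ne x'$; (c) $D_{x,x'}$ is the image of $D_{x',x}$ under the flip $A_{x'}\otimes A_x\to A_x\otimes A_{x'}$; (d) $\mathfrak M D_{x,x''}\le D_{x,x'}\otimes 1_{x''}+1_x\otimes D_{x',x''}$ in $A_x\otimes A_{x'}\otimes A_{x''}$ for all $x,x',x''$, where $\mathfrak M(a\otimes c)=a\otimes 1_{x'}\otimes c$. For an operator field $f$ put $\|f\|_D=\sup_{x\neq x'}\|D_{x,x'}^{-1/2}(f(x)\otimes 1_{x'}-1_x\otimes f(x'))D_{x,x'}^{-1/2}\|\in[0,\infty]$ and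 $\|f\|_{\mathrm{Lip}}=\|f\|_\infty+\|f\|_D$. Let $L(D)=\{f\in\ell_\infty(\mathcal A_X):\|f\|_D<\infty\}$ and, for $x_0\in X$, $L_0(D)=\{f:\|f\|_D<\infty,\ f(x_0)=0\}$. Let $\mathrm{Lip}(D)\subseteq L(D)$ and $\mathrm{Lip}_0(D)\subseteq L_0(D)$ be the subspaces of those $f$ that commute with $D$, i.e. $D_{x,x'}$ commutes with $f(x)\otimes 1_{x'}$ for all $x,x'$. $D$ is central if $D_{x,x'}\in Z(A_x)\otimes Z(A_{x'})$ for all $x,x'$, where $Z$ denotes the center. Put $D^{\|\cdot\|}(x,x')=\|D_{x,x'}\|$ for $x\neq x'$ and $D^{\|\cdot\|}(x,x)=0$. Theorem. Let $D$ be a mof on $\mathcal A_X$ (and $x_0\in X$ any base point, in the statements involving $L_0$ or $\mathrm{Lip}_0$). (i) $(L(D),\|\cdot\|_{\mathrm{Lip}})$ is a Banach space. (ii) $(\mathrm{Lip}(D),\|\cdot\|_{\mathrm{Lip}})$, with pointwise operations, is a unital Banach *-algebra (with isometric involution), and $\mathrm{Lip}_0(D)\cap\ell_\infty(\mathcal A_X)$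 is a closed two-sided ideal in it. (iii) $L_0(D)$ and $\mathrm{Lip}_0(D)$ are Banach spaces with the norm $\|\cdot\|_D$. (iv) If $\sup_{x,x'}\|D_{x,x'}\|<\infty$, then $L_0(D)\subseteq L(D)$. (v) If $\sup_{x\ne x'}\|D_{x,x'}^{-1}\|<\infty$, then $L(D)=\ell_\infty(\mathcal A_X)$, and $(X,D^{\|\cdot\|})$ is a metric space whose topology is discrete. (vi) If $\sup_{x\neq x'}\|D_{x,x'}\|<\infty$ and $\sup_{x\neq x'}\|D_{x,x'}^{-1}\|<\infty$, then $L(D)=\ell_\infty(\mathcal A_X)$ and the multiplication $L(D)\times L(D)\to L(D)$ is continuous for $\|\cdot\|_{\mathrm{Lip}}$. (vii) If $D$ is central, then $L_0(D)=\mathrm{Lip}_0(D)$ and $L(D)=\mathrm{Lip}(D)$. -/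

import Mathlib

open scoped TensorProduct ComplexOrder ENNReal InnerProductSpace

noncomputable section

namespace MOF

universe u v

/-! ### The Hilbert space tensor product -/

/-- The completed tensor product of two Hilbert spaces. -/
def HilbertTensor (H K : Type u) [NormedAddCommGroup H] [InnerProductSpace ℂ H]
    [NormedAddCommGroup K] [InnerProductSpace ℂ K] : Type u :=
  UniformSpace.Completion (H ⊗[ℂ] K)

section HilbertTensor

open UniformSpace

variable {H K : Type u} [NormedAddCommGroup H] [InnerProductSpace ℂ H]
  [NormedAddCommGroup K] [InnerProductSpace ℂ K]

instance HilbertTensor.instNormedAddCommGroup : NormedAddCommGroup (HilbertTensor H K) :=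
  inferInstanceAs (NormedAddCommGroup (Completion (H ⊗[ℂ] K)))
instance HilbertTensor.instInnerProductSpace : InnerProductSpace ℂ (HilbertTensor H K) :=
  inferInstanceAs (InnerProductSpace ℂ (Completion (H ⊗[ℂ] K)))
instance HilbertTensor.instCompleteSpace : CompleteSpace (HilbertTensor H K) :=
  inferInstanceAs (CompleteSpace (Completion (H ⊗[ℂ] K)))

/-- The vector `h ⊗ k`. -/
def HilbertTensor.tmul (h : H) (k : K) : HilbertTensor H K :=
  ((h ⊗ₜ[ℂ] k : H ⊗[ℂ] K) : Completion (H ⊗[ℂ] K))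

theorem HilbertTensor.inner_tmul (h h' : H) (k k' : K) :
    ⟪HilbertTensor.tmul h k, HilbertTensor.tmul h' k'⟫_ℂ = ⟪h, h'⟫_ℂ * ⟪k, k'⟫_ℂ := by
  refine (Completion.inner_coe (𝕜 := ℂ) (E := H ⊗[ℂ] K) _ _).trans ?_
  exact TensorProduct.inner_tmul (𝕜 := ℂ) h h' k k'

theorem HilbertTensor.tmul_add (h : H) (k k' : K) : HilbertTensor.tmul h (k + k')
    = HilbertTensor.tmul h k + HilbertTensor.tmul h k' := by
  refine (congrArg _ (TensorProduct.tmul_add h k k')).trans ?_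
  exact Completion.coe_add _ _

theorem HilbertTensor.add_tmul (h h' : H) (k : K) : HilbertTensor.tmul (h + h') k
    = HilbertTensor.tmul h k + HilbertTensor.tmul h' k := by
  refine (congrArg _ (TensorProduct.add_tmul h h' k)).trans ?_
  exact Completion.coe_add _ _

theorem HilbertTensor.tmul_smul (c : ℂ) (h : H) (k : K) : HilbertTensor.tmul h (c • k)
    = c • HilbertTensor.tmul h k := by
  refine (congrArg _ (TensorProduct.tmul_smul c h k)).trans ?_
  exact Completion.coe_smul _ _

theorem HilbertTensor.smul_tmul (c : ℂ) (h : H) (k : K) : HilbertTensor.tmul (c • h) k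
    = c • HilbertTensor.tmul h k := by
  refine (congrArg _ (TensorProduct.smul_tmul' c h k).symm).trans ?_
  exact Completion.coe_smul _ _

theorem HilbertTensor.induction {P : HilbertTensor H K → Prop} (x : HilbertTensor H K)
    (hc : IsClosed {x | P x}) (h0 : P 0) (ht : ∀ h k, P (HilbertTensor.tmul h k))
    (ha : ∀ x y, P x → P y → P (x + y)) : P x := by
  refine Completion.induction_on (α := H ⊗[ℂ] K) (p := P) x hc fun y => ?_
  refine TensorProduct.induction_on (motive := fun y => P (y : Completion (H ⊗[ℂ] K))) y ?_ ht ?_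
  · exact (congrArg P Completion.coe_zero).mpr h0
  · exact fun y z hy hz => (congrArg P (Completion.coe_add y z)).mpr (ha _ _ hy hz)

theorem HilbertTensor.op_ext {S T : HilbertTensor H K →L[ℂ] HilbertTensor H K}
    (h : ∀ a b, S (HilbertTensor.tmul a b) = T (HilbertTensor.tmul a b)) : S = T := by
  ext x
  induction x using HilbertTensor.induction with
  | hc => exact isClosed_eq S.continuous T.continuous
  | h0 => rw [map_zero, map_zero]
  | ht a b => exact h a b
  | ha x y hx hy => rw [map_add, map_add, hx, hy]

/-- The bounded operator `S ⊗ T` on the completed tensor product. -/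
def opTensor (S : H →L[ℂ] H) (T : K →L[ℂ] K) : HilbertTensor H K →L[ℂ] HilbertTensor H K :=
  (TensorProduct.mapL S T).completion

theorem opTensor_tmul (S : H →L[ℂ] H) (T : K →L[ℂ] K) (h : H) (k : K) :
    opTensor S T (HilbertTensor.tmul h k) = HilbertTensor.tmul (S h) (T k) :=
  ContinuousLinearMap.completion_apply_coe (TensorProduct.mapL S T) (h ⊗ₜ[ℂ] k)

theorem norm_opTensor_le (S : H →L[ℂ] H) (T : K →L[ℂ] K) : ‖opTensor S T‖ ≤ ‖S‖ * ‖T‖ := by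
  refine ContinuousLinearMap.opNorm_le_bound _ (by positivity) fun x => ?_
  refine Completion.induction_on (α := H ⊗[ℂ] K)
    (p := fun x : HilbertTensor H K => ‖opTensor S T x‖ ≤ ‖S‖ * ‖T‖ * ‖x‖) x
    (isClosed_le (opTensor S T).continuous.norm (continuous_const.mul continuous_norm)) fun y => ?_
  have h1 : ‖opTensor S T (y : Completion (H ⊗[ℂ] K))‖ = ‖TensorProduct.mapL S T y‖ :=
    (congrArg norm (ContinuousLinearMap.completion_apply_coe (TensorProduct.mapL S T) y)).trans
      (Completion.norm_coe _)
  refine h1.le.trans (((TensorProduct.mapL S T).le_opNorm y).trans ?_)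
  refine (mul_le_mul_of_nonneg_right (TensorProduct.norm_mapL_le S T) (norm_nonneg y)).trans ?_
  exact (congrArg (fun r => ‖S‖ * ‖T‖ * r) (Completion.norm_coe y).symm).le

theorem star_opTensor [CompleteSpace H] [CompleteSpace K] (S : H →L[ℂ] H) (T : K →L[ℂ] K) :
    star (opTensor S T) = opTensor (star S) (star T) := by
  symm
  refine (ContinuousLinearMap.eq_adjoint_iff _ _).mpr fun x y => ?_
  induction x using HilbertTensor.induction with
  | hc => exact isClosed_eq (by fun_prop) (by fun_prop)
  | h0 => simp
  | ha x₁ x₂ h₁ h₂ => rw [map_add, inner_add_left, inner_add_left, h₁, h₂]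
  | ht h k =>
    induction y using HilbertTensor.induction with
    | hc => exact isClosed_eq (by fun_prop) (by fun_prop)
    | h0 => simp
    | ha y₁ y₂ h₁ h₂ => rw [map_add, inner_add_right, inner_add_right, h₁, h₂]
    | ht h' k' =>
      rw [opTensor_tmul, opTensor_tmul, HilbertTensor.inner_tmul, HilbertTensor.inner_tmul,
        ContinuousLinearMap.star_eq_adjoint, ContinuousLinearMap.star_eq_adjoint,
        ContinuousLinearMap.adjoint_inner_left, ContinuousLinearMap.adjoint_inner_left]

/-- The flip `H ⊗ K → K ⊗ H`. -/
def HilbertTensor.flip : HilbertTensor H K →L[ℂ] HilbertTensor K H :=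
  (TensorProduct.commIsometry ℂ H K).toContinuousLinearEquiv.toContinuousLinearMap.completion

theorem HilbertTensor.flip_tmul (h : H) (k : K) :
    HilbertTensor.flip (HilbertTensor.tmul h k) = HilbertTensor.tmul k h :=
  ContinuousLinearMap.completion_apply_coe
    (TensorProduct.commIsometry ℂ H K).toContinuousLinearEquiv.toContinuousLinearMap (h ⊗ₜ[ℂ] k)

theorem HilbertTensor.flip_flip (x : HilbertTensor H K) :
    HilbertTensor.flip (HilbertTensor.flip x) = x := by
  induction x using HilbertTensor.induction with
  | hc => exact isClosed_eq (by fun_prop) continuous_id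
  | h0 => rw [map_zero, map_zero]
  | ht a b => rw [HilbertTensor.flip_tmul, HilbertTensor.flip_tmul]
  | ha x y hx hy => rw [map_add, map_add, hx, hy]

theorem HilbertTensor.norm_flip (x : HilbertTensor H K) : ‖HilbertTensor.flip x‖ = ‖x‖ := by
  refine Completion.induction_on (α := H ⊗[ℂ] K)
    (p := fun x : HilbertTensor H K => ‖HilbertTensor.flip x‖ = ‖x‖) x
    (isClosed_eq HilbertTensor.flip.continuous.norm continuous_norm) fun y => ?_
  refine (congrArg norm (ContinuousLinearMap.completion_apply_coe
    (TensorProduct.commIsometry ℂ H K).toContinuousLinearEquiv.toContinuousLinearMap y)).trans ?_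
  refine (Completion.norm_coe _).trans ?_
  refine ((TensorProduct.commIsometry ℂ H K).norm_map y).trans ?_
  exact (Completion.norm_coe (E := H ⊗[ℂ] K) y).symm

end HilbertTensor

/-! ### The spatial tensor product of two unital C*-algebras -/

/-- A unital *-representation of a C*-algebra on a Hilbert space. -/
structure HilbertRep (A : Type u) [CStarAlgebra A] : Type (u + 1) where
  H : Type u
  [grp : NormedAddCommGroup H]
  [ips : InnerProductSpace ℂ H]
  [complete : CompleteSpace H]
  π : A →⋆ₐ[ℂ] (H →L[ℂ] H)

attribute [instance] HilbertRep.grp HilbertRep.ips HilbertRep.complete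

/-- Restriction of a representation along a *-homomorphism. -/
def HilbertRep.comp {A C : Type u} [CStarAlgebra A] [CStarAlgebra C] (p : HilbertRep C)
    (f : A →⋆ₐ[ℂ] C) : HilbertRep A where
  H := p.H
  π := p.π.comp f

/-- The algebraic tensor product of two C*-algebras (over `ℂ`), as a *-algebra. It is a synonym of
`A ⊗[ℂ] B` that carries the spatial (minimal) C*-seminorm. -/
def AlgTensor (A B : Type u) [CStarAlgebra A] [CStarAlgebra B] : Type u := A ⊗[ℂ] B

section AlgTensor

variable {A B C E : Type u} [CStarAlgebra A] [CStarAlgebra B] [CStarAlgebra C] [CStarAlgebra E]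

instance AlgTensor.instRing : Ring (AlgTensor A B) := inferInstanceAs (Ring (A ⊗[ℂ] B))
instance AlgTensor.instAlgebra : Algebra ℂ (AlgTensor A B) :=
  inferInstanceAs (Algebra ℂ (A ⊗[ℂ] B))
instance AlgTensor.instStarRing : StarRing (AlgTensor A B) :=
  inferInstanceAs (StarRing (A ⊗[ℂ] B))
instance AlgTensor.instStarModule : StarModule ℂ (AlgTensor A B) :=
  inferInstanceAs (StarModule ℂ (A ⊗[ℂ] B))

/-- The elementary tensor `a ⊗ b`. -/
def AlgTensor.tmul (a : A) (b : B) : AlgTensor A B := a ⊗ₜ[ℂ] b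

theorem AlgTensor.star_tmul (a : A) (b : B) :
    star (AlgTensor.tmul a b) = AlgTensor.tmul (star a) (star b) := rfl

theorem AlgTensor.induction {P : AlgTensor A B → Prop} (t : AlgTensor A B) (h0 : P 0)
    (ht : ∀ a b, P (AlgTensor.tmul a b)) (ha : ∀ s t, P s → P t → P (s + t)) : P t :=
  TensorProduct.induction_on (motive := P) t h0 ht ha

/-- The representation `π ⊗ ρ` of `A ⊗ B` by bounded operators on the tensor product of the
Hilbert spaces of `π` and `ρ`. -/
def tensorRepAlgHom (p : HilbertRep A) (q : HilbertRep B) :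
    AlgTensor A B →ₐ[ℂ] (HilbertTensor p.H q.H →L[ℂ] HilbertTensor p.H q.H) :=
  Algebra.TensorProduct.lift
    (AlgHom.ofLinearMap
      { toFun := fun a => opTensor (p.π a) 1
        map_add' := fun a b => HilbertTensor.op_ext fun h k => by
          simp [opTensor_tmul, HilbertTensor.add_tmul]
        map_smul' := fun c a => HilbertTensor.op_ext fun h k => by
          simp [opTensor_tmul, HilbertTensor.smul_tmul] }
      (HilbertTensor.op_ext fun h k => by simp [opTensor_tmul])
      (fun a b => HilbertTensor.op_ext fun h k => by simp [opTensor_tmul]))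
    (AlgHom.ofLinearMap
      { toFun := fun b => opTensor 1 (q.π b)
        map_add' := fun a b => HilbertTensor.op_ext fun h k => by
          simp [opTensor_tmul, HilbertTensor.tmul_add]
        map_smul' := fun c a => HilbertTensor.op_ext fun h k => by
          simp [opTensor_tmul, HilbertTensor.tmul_smul] }
      (HilbertTensor.op_ext fun h k => by simp [opTensor_tmul])
      (fun a b => HilbertTensor.op_ext fun h k => by simp [opTensor_tmul]))
    (fun a b => HilbertTensor.op_ext fun h k => by simp [opTensor_tmul])

theorem tensorRepAlgHom_tmul (p : HilbertRep A) (q : HilbertRep B) (a : A) (b : B) :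
    tensorRepAlgHom p q (AlgTensor.tmul a b) = opTensor (p.π a) (q.π b) := by
  refine (Algebra.TensorProduct.lift_tmul _ _ _ a b).trans ?_
  exact HilbertTensor.op_ext fun h k => by simp [opTensor_tmul]

/-- The representation `π ⊗ ρ` as a *-homomorphism. -/
def tensorRep (p : HilbertRep A) (q : HilbertRep B) :
    AlgTensor A B →⋆ₐ[ℂ] (HilbertTensor p.H q.H →L[ℂ] HilbertTensor p.H q.H) where
  __ := tensorRepAlgHom p q
  map_star' t := by
    change tensorRepAlgHom p q (star t) = star (tensorRepAlgHom p q t)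
    induction t using AlgTensor.induction with
    | h0 => simp
    | ha s t hs ht => rw [star_add, map_add, map_add, star_add, hs, ht]
    | ht a b =>
      rw [AlgTensor.star_tmul, tensorRepAlgHom_tmul, tensorRepAlgHom_tmul, star_opTensor,
        map_star, map_star]

theorem tensorRep_tmul (p : HilbertRep A) (q : HilbertRep B) (a : A) (b : B) :
    tensorRep p q (AlgTensor.tmul a b) = opTensor (p.π a) (q.π b) :=
  tensorRepAlgHom_tmul p q a b

theorem exists_norm_tensorRep_le (t : AlgTensor A B) :
    ∃ C : ℝ, ∀ (p : HilbertRep A) (q : HilbertRep B), ‖tensorRep p q t‖ ≤ C := by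
  induction t using AlgTensor.induction with
  | h0 => exact ⟨0, fun p q => by rw [map_zero, norm_zero]⟩
  | ha s t hs ht =>
    obtain ⟨C, hC⟩ := hs
    obtain ⟨C', hC'⟩ := ht
    refine ⟨C + C', fun p q => ?_⟩
    rw [map_add]
    exact (norm_add_le _ _).trans (add_le_add (hC p q) (hC' p q))
  | ht a b =>
    refine ⟨‖a‖ * ‖b‖, fun p q => ?_⟩
    rw [tensorRep_tmul]
    refine (norm_opTensor_le _ _).trans ?_
    gcongr
    · exact NonUnitalStarAlgHom.norm_apply_le p.π a
    · exact NonUnitalStarAlgHom.norm_apply_le q.π b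

/-- The spatial norm: the supremum of `‖(π ⊗ ρ)(t)‖` over all representations `π` of `A` and
`ρ` of `B` on Hilbert spaces. -/
def spatialNorm (t : AlgTensor A B) : ℝ :=
  ⨆ r : HilbertRep A × HilbertRep B, ‖tensorRep r.1 r.2 t‖

theorem bddAbove_spatialNorm (t : AlgTensor A B) :
    BddAbove (Set.range fun r : HilbertRep A × HilbertRep B => ‖tensorRep r.1 r.2 t‖) := by
  obtain ⟨C, hC⟩ := exists_norm_tensorRep_le t
  exact ⟨C, by rintro _ ⟨r, rfl⟩; exact hC r.1 r.2⟩

theorem norm_tensorRep_le_spatialNorm (p : HilbertRep A) (q : HilbertRep B) (t : AlgTensor A B) :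
    ‖tensorRep p q t‖ ≤ spatialNorm t :=
  le_ciSup (bddAbove_spatialNorm t) (p, q)

theorem spatialNorm_nonneg (t : AlgTensor A B) : 0 ≤ spatialNorm t :=
  Real.iSup_nonneg fun _ => norm_nonneg _

theorem spatialNorm_le {t : AlgTensor A B} {C : ℝ} (hC : 0 ≤ C)
    (h : ∀ (p : HilbertRep A) (q : HilbertRep B), ‖tensorRep p q t‖ ≤ C) : spatialNorm t ≤ C :=
  Real.iSup_le (fun r => h r.1 r.2) hC

theorem spatialNorm_mul_le (s t : AlgTensor A B) :
    spatialNorm (s * t) ≤ spatialNorm s * spatialNorm t := by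
  refine spatialNorm_le (mul_nonneg (spatialNorm_nonneg s) (spatialNorm_nonneg t)) fun p q => ?_
  rw [map_mul]
  exact (norm_mul_le _ _).trans (mul_le_mul (norm_tensorRep_le_spatialNorm p q s)
    (norm_tensorRep_le_spatialNorm p q t) (norm_nonneg _) (spatialNorm_nonneg s))

theorem spatialNorm_mul_self_le (t : AlgTensor A B) :
    spatialNorm t * spatialNorm t ≤ spatialNorm (star t * t) := by
  have h : spatialNorm t ≤ √(spatialNorm (star t * t)) :=
    spatialNorm_le (Real.sqrt_nonneg _) fun p q => Real.le_sqrt_of_sq_le <| by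
      rw [sq, ← CStarRing.norm_star_mul_self, ← map_star, ← map_mul]
      exact norm_tensorRep_le_spatialNorm p q _
  calc spatialNorm t * spatialNorm t
      ≤ √(spatialNorm (star t * t)) * √(spatialNorm (star t * t)) :=
        mul_le_mul h h (spatialNorm_nonneg t) (Real.sqrt_nonneg _)
    _ = _ := Real.mul_self_sqrt (spatialNorm_nonneg _)

/-- The spatial norm as a ring seminorm. -/
def spatialRingSeminorm : RingSeminorm (AlgTensor A B) where
  toFun := spatialNorm
  map_zero' := by
    have h : ∀ r : HilbertRep A × HilbertRep B, ‖tensorRep r.1 r.2 0‖ = 0 := fun r => by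
      rw [map_zero, norm_zero]
    simp only [spatialNorm, h, Real.iSup_const_zero]
  add_le' s t := by
    refine spatialNorm_le (add_nonneg (spatialNorm_nonneg s) (spatialNorm_nonneg t)) fun p q => ?_
    rw [map_add]
    exact (norm_add_le _ _).trans (add_le_add (norm_tensorRep_le_spatialNorm p q s)
      (norm_tensorRep_le_spatialNorm p q t))
  neg' t := by simp only [spatialNorm, map_neg, norm_neg]
  mul_le' := spatialNorm_mul_le

instance AlgTensor.instSeminormedRing : SeminormedRing (AlgTensor A B) :=
  spatialRingSeminorm.toSeminormedRing

theorem AlgTensor.norm_def (t : AlgTensor A B) : ‖t‖ = spatialNorm t := rfl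

instance AlgTensor.instNormedSpace : NormedSpace ℂ (AlgTensor A B) where
  norm_smul_le c t := by
    rw [AlgTensor.norm_def, AlgTensor.norm_def]
    refine spatialNorm_le (mul_nonneg (norm_nonneg _) (spatialNorm_nonneg t)) fun p q => ?_
    rw [map_smul, norm_smul]
    exact mul_le_mul_of_nonneg_left (norm_tensorRep_le_spatialNorm p q t) (norm_nonneg _)

theorem AlgTensor.norm_mul_self_le (t : AlgTensor A B) : ‖t‖ * ‖t‖ ≤ ‖star t * t‖ :=
  spatialNorm_mul_self_le t

theorem AlgTensor.norm_star_le (t : AlgTensor A B) : ‖star t‖ ≤ ‖t‖ := by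
  have h := (AlgTensor.norm_mul_self_le (star t)).trans (norm_mul_le _ _)
  rw [star_star] at h
  rcases (norm_nonneg (star t)).eq_or_lt with h0 | h0
  · rw [← h0]; exact norm_nonneg _
  · exact le_of_mul_le_mul_right h h0

end AlgTensor

/-- The completed spatial tensor product `A ⊗ B` of unital C*-algebras. -/
abbrev SpatialTensor (A B : Type u) [CStarAlgebra A] [CStarAlgebra B] : Type u :=
  UniformSpace.Completion (AlgTensor A B)

namespace SpatialTensor

open UniformSpace

variable {A B C E : Type u} [CStarAlgebra A] [CStarAlgebra B] [CStarAlgebra C] [CStarAlgebra E]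

/-- The involution on the algebraic tensor product, as a bounded additive map. -/
def starAddHom : AlgTensor A B →+ AlgTensor A B where
  toFun := star
  map_zero' := star_zero _
  map_add' := star_add

theorem continuous_starAddHom : Continuous (starAddHom : AlgTensor A B →+ AlgTensor A B) :=
  AddMonoidHomClass.continuous_of_bound _ 1 fun t => by
    rw [one_mul]; exact AlgTensor.norm_star_le t

instance instStar : Star (SpatialTensor A B) where
  star := Completion.map star

theorem continuous_star' : Continuous (star : SpatialTensor A B → SpatialTensor A B) :=
  Completion.continuous_map

theorem star_coe (t : AlgTensor A B) :
    star (t : SpatialTensor A B) = ((star t : AlgTensor A B) : SpatialTensor A B) :=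
  Completion.map_coe (uniformContinuous_addMonoidHom_of_continuous continuous_starAddHom) t

instance instStarRing : StarRing (SpatialTensor A B) where
  star_involutive x := by
    induction x using Completion.induction_on with
    | hp => exact isClosed_eq (continuous_star'.comp continuous_star') continuous_id
    | ih t => rw [star_coe, star_coe, star_star]
  star_mul x y := by
    induction x, y using Completion.induction_on₂ with
    | hp =>
      exact isClosed_eq (continuous_star'.comp continuous_mul)
        ((continuous_star'.comp continuous_snd).mul (continuous_star'.comp continuous_fst))
    | ih s t =>
      rw [← Completion.coe_mul, star_coe, star_coe, star_coe, ← Completion.coe_mul, star_mul]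
  star_add x y := by
    induction x, y using Completion.induction_on₂ with
    | hp =>
      exact isClosed_eq (continuous_star'.comp continuous_add)
        ((continuous_star'.comp continuous_fst).add (continuous_star'.comp continuous_snd))
    | ih s t =>
      rw [← Completion.coe_add, star_coe, star_coe, star_coe, ← Completion.coe_add, star_add]

instance instCStarAlgebra : CStarAlgebra (SpatialTensor A B) where
  norm_smul_le := norm_smul_le
  star_smul r x := by
    induction x using Completion.induction_on with
    | hp =>
      exact isClosed_eq (continuous_star'.comp (continuous_const_smul r))
        ((continuous_const_smul (star r)).comp continuous_star')
    | ih t =>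
      rw [← Completion.coe_smul, star_coe, star_coe, ← Completion.coe_smul, star_smul]
  norm_mul_self_le x := by
    induction x using Completion.induction_on with
    | hp =>
      exact isClosed_le (by fun_prop) ((continuous_star'.mul continuous_id).norm)
    | ih t =>
      rw [star_coe, ← Completion.coe_mul, Completion.norm_coe, Completion.norm_coe]
      exact AlgTensor.norm_mul_self_le t

/-- `a ≤ b` means that `b - a` is a positive element. -/
instance instPartialOrder : PartialOrder (SpatialTensor A B) := CStarAlgebra.spectralOrder _

instance instStarOrderedRing : StarOrderedRing (SpatialTensor A B) :=
  CStarAlgebra.spectralOrderedRing _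

/-- The elementary tensor `a ⊗ b`. -/
def tmul (a : A) (b : B) : SpatialTensor A B := (AlgTensor.tmul a b : AlgTensor A B)

/-- A contractive *-homomorphism of algebraic tensor products extends to the completions. -/
def extendHom (φ : AlgTensor A B →⋆ₐ[ℂ] AlgTensor C E) (hφ : ∀ t, ‖φ t‖ ≤ ‖t‖) :
    SpatialTensor A B →⋆ₐ[ℂ] SpatialTensor C E :=
  have hc : Continuous (φ : AlgTensor A B →+* AlgTensor C E) :=
    AddMonoidHomClass.continuous_of_bound φ 1 fun t => by rw [one_mul]; exact hφ t
  have hm : ∀ t : AlgTensor A B, Completion.map φ (t : SpatialTensor A B) = (φ t : AlgTensor C E) :=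
    Completion.map_coe (uniformContinuous_addMonoidHom_of_continuous hc)
  { Completion.mapRingHom (φ : AlgTensor A B →+* AlgTensor C E) hc with
    commutes' := fun r => by
      change Completion.map φ ((algebraMap ℂ (AlgTensor A B) r : AlgTensor A B)) = _
      exact (hm _).trans (congrArg _ (φ.commutes' r))
    map_star' := fun x => by
      change Completion.map φ (star x) = star (Completion.map φ x)
      induction x using Completion.induction_on with
      | hp =>
        exact isClosed_eq (Completion.continuous_map.comp continuous_star')
          (continuous_star'.comp Completion.continuous_map)
      | ih t =>
        rw [star_coe, hm, hm, star_coe, map_star] }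

theorem extendHom_coe (φ : AlgTensor A B →⋆ₐ[ℂ] AlgTensor C E) (hφ : ∀ t, ‖φ t‖ ≤ ‖t‖)
    (t : AlgTensor A B) : extendHom φ hφ (t : SpatialTensor A B) = (φ t : AlgTensor C E) :=
  have hc : Continuous (φ : AlgTensor A B →+* AlgTensor C E) :=
    AddMonoidHomClass.continuous_of_bound φ 1 fun t => by rw [one_mul]; exact hφ t
  Completion.map_coe (uniformContinuous_addMonoidHom_of_continuous hc) t

/-- The embedding `a ↦ a ⊗ 1`. -/
def inl : A →⋆ₐ[ℂ] SpatialTensor A B where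
  toFun a := tmul a 1
  map_one' := rfl
  map_mul' a b := by
    change ((_ : AlgTensor A B) : SpatialTensor A B) = (_ : AlgTensor A B) * (_ : AlgTensor A B)
    rw [← Completion.coe_mul]
    exact congrArg _ ((Algebra.TensorProduct.includeLeft : A →ₐ[ℂ] A ⊗[ℂ] B).map_mul a b)
  map_zero' := congrArg _ (TensorProduct.zero_tmul A (1 : B))
  map_add' a b := by
    change ((_ : AlgTensor A B) : SpatialTensor A B) = (_ : AlgTensor A B) + (_ : AlgTensor A B)
    rw [← Completion.coe_add]
    exact congrArg _ ((Algebra.TensorProduct.includeLeft : A →ₐ[ℂ] A ⊗[ℂ] B).map_add a b)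
  commutes' r :=
    congrArg (fun t : AlgTensor A B => (t : SpatialTensor A B))
      ((Algebra.TensorProduct.includeLeft : A →ₐ[ℂ] A ⊗[ℂ] B).commutes r)
  map_star' a := by
    change _ = star ((AlgTensor.tmul a 1 : AlgTensor A B) : SpatialTensor A B)
    rw [star_coe, AlgTensor.star_tmul, star_one]
    rfl

/-- The embedding `b ↦ 1 ⊗ b`. -/
def inr : B →⋆ₐ[ℂ] SpatialTensor A B where
  toFun b := tmul 1 b
  map_one' := rfl
  map_mul' a b := by
    change ((_ : AlgTensor A B) : SpatialTensor A B) = (_ : AlgTensor A B) * (_ : AlgTensor A B)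
    rw [← Completion.coe_mul]
    exact congrArg _ ((Algebra.TensorProduct.includeRight : B →ₐ[ℂ] A ⊗[ℂ] B).map_mul a b)
  map_zero' := congrArg _ (TensorProduct.tmul_zero B (1 : A))
  map_add' a b := by
    change ((_ : AlgTensor A B) : SpatialTensor A B) = (_ : AlgTensor A B) + (_ : AlgTensor A B)
    rw [← Completion.coe_add]
    exact congrArg _ ((Algebra.TensorProduct.includeRight : B →ₐ[ℂ] A ⊗[ℂ] B).map_add a b)
  commutes' r :=
    congrArg (fun t : AlgTensor A B => (t : SpatialTensor A B))
      ((Algebra.TensorProduct.includeRight : B →ₐ[ℂ] A ⊗[ℂ] B).commutes r)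
  map_star' a := by
    change _ = star ((AlgTensor.tmul 1 a : AlgTensor A B) : SpatialTensor A B)
    rw [star_coe, AlgTensor.star_tmul, star_one]
    rfl

/-- `f ⊗ g` on the algebraic tensor products. -/
def algMap (f : A →⋆ₐ[ℂ] C) (g : B →⋆ₐ[ℂ] E) : AlgTensor A B →⋆ₐ[ℂ] AlgTensor C E where
  __ := (Algebra.TensorProduct.map f.toAlgHom g.toAlgHom : A ⊗[ℂ] B →ₐ[ℂ] C ⊗[ℂ] E)
  map_star' t := by
    change Algebra.TensorProduct.map f.toAlgHom g.toAlgHom (star t : A ⊗[ℂ] B)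
      = star (Algebra.TensorProduct.map f.toAlgHom g.toAlgHom (t : A ⊗[ℂ] B))
    refine TensorProduct.induction_on t ?_ ?_ ?_
    · simp
    · intro a b
      simp [map_star]
    · intro s t hs ht
      rw [star_add, map_add, map_add, star_add, hs, ht]

theorem algMap_tmul (f : A →⋆ₐ[ℂ] C) (g : B →⋆ₐ[ℂ] E) (a : A) (b : B) :
    algMap f g (AlgTensor.tmul a b) = AlgTensor.tmul (f a) (g b) := rfl

theorem norm_algMap_le (f : A →⋆ₐ[ℂ] C) (g : B →⋆ₐ[ℂ] E) (t : AlgTensor A B) :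
    ‖algMap f g t‖ ≤ ‖t‖ := by
  refine spatialNorm_le (norm_nonneg t) fun p q => ?_
  have h : tensorRep p q (algMap f g t) = tensorRep (p.comp f) (q.comp g) t := by
    induction t using AlgTensor.induction with
    | h0 =>
      exact ((congrArg (tensorRep p q) (map_zero (algMap f g))).trans (map_zero _)).trans
        (map_zero (tensorRep (p.comp f) (q.comp g))).symm
    | ha s t hs ht =>
      exact (((congrArg (tensorRep p q) (map_add (algMap f g) s t)).trans (map_add _ _ _)).trans
        (congrArg₂ (fun x y => x + y) hs ht)).trans
          (map_add (tensorRep (p.comp f) (q.comp g)) s t).symm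
    | ht a b =>
      rw [algMap_tmul, tensorRep_tmul]
      exact (tensorRep_tmul (p.comp f) (q.comp g) a b).symm
  rw [h]
  exact norm_tensorRep_le_spatialNorm _ _ t

/-- The *-homomorphism `f ⊗ g` between spatial tensor products, `a ⊗ b ↦ f a ⊗ g b`. -/
def map (f : A →⋆ₐ[ℂ] C) (g : B →⋆ₐ[ℂ] E) : SpatialTensor A B →⋆ₐ[ℂ] SpatialTensor C E :=
  extendHom (algMap f g) (norm_algMap_le f g)

theorem map_tmul (f : A →⋆ₐ[ℂ] C) (g : B →⋆ₐ[ℂ] E) (a : A) (b : B) :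
    map f g (tmul a b) = tmul (f a) (g b) :=
  extendHom_coe _ _ _

/-- The flip on the algebraic tensor product. -/
def algFlip : AlgTensor A B →⋆ₐ[ℂ] AlgTensor B A where
  __ := ((Algebra.TensorProduct.comm ℂ A B).toAlgHom : A ⊗[ℂ] B →ₐ[ℂ] B ⊗[ℂ] A)
  map_star' t := by
    change Algebra.TensorProduct.comm ℂ A B (star t : A ⊗[ℂ] B)
      = star (Algebra.TensorProduct.comm ℂ A B (t : A ⊗[ℂ] B))
    refine TensorProduct.induction_on t ?_ ?_ ?_
    · simp
    · intro a b
      simp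
    · intro s t hs ht
      rw [star_add, map_add, map_add, star_add, hs, ht]

theorem algFlip_tmul (a : A) (b : B) :
    algFlip (AlgTensor.tmul a b) = AlgTensor.tmul b a := rfl

theorem norm_algFlip_le (t : AlgTensor A B) : ‖algFlip t‖ ≤ ‖t‖ := by
  refine spatialNorm_le (norm_nonneg t) fun p q => ?_
  have h : ∀ x, tensorRep p q (algFlip t) (HilbertTensor.flip x)
      = HilbertTensor.flip (tensorRep q p t x) := by
    intro x
    induction t using AlgTensor.induction with
    | h0 => simp only [map_zero, zero_apply]
    | ha s t hs ht => simp only [map_add, add_apply, hs, ht]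
    | ht a b =>
      rw [algFlip_tmul, tensorRep_tmul, tensorRep_tmul]
      induction x using HilbertTensor.induction with
      | hc => exact isClosed_eq (by fun_prop) (by fun_prop)
      | h0 => simp only [map_zero]
      | ha x y hx hy => simp only [map_add, hx, hy]
      | ht h k =>
        rw [HilbertTensor.flip_tmul, opTensor_tmul, opTensor_tmul, HilbertTensor.flip_tmul]
  refine ContinuousLinearMap.opNorm_le_bound _ (norm_nonneg t) fun x => ?_
  have h1 := h (HilbertTensor.flip x)
  rw [HilbertTensor.flip_flip] at h1
  rw [h1, HilbertTensor.norm_flip]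
  calc ‖tensorRep q p t (HilbertTensor.flip x)‖
      ≤ ‖tensorRep q p t‖ * ‖HilbertTensor.flip x‖ := ContinuousLinearMap.le_opNorm _ _
    _ ≤ ‖t‖ * ‖x‖ := by
      rw [HilbertTensor.norm_flip]
      exact mul_le_mul_of_nonneg_right (norm_tensorRep_le_spatialNorm q p t) (norm_nonneg x)

/-- The flip `A ⊗ B → B ⊗ A`, `a ⊗ b ↦ b ⊗ a`. -/
def flip : SpatialTensor A B →⋆ₐ[ℂ] SpatialTensor B A := extendHom algFlip norm_algFlip_le

theorem flip_tmul (a : A) (b : B) : flip (tmul a b) = tmul b a := extendHom_coe _ _ _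

end SpatialTensor

/-! ### States -/

/-- A state of a unital C*-algebra: a positive linear functional of value `1` at the unit. -/
structure State (A : Type u) [CStarAlgebra A] where
  toLinearMap : A →ₗ[ℂ] ℂ
  nonneg : ∀ a, 0 ≤ toLinearMap (star a * a)
  map_one : toLinearMap 1 = 1

section State

open UniformSpace

variable {A B : Type u} [CStarAlgebra A] [CStarAlgebra B]

/-- The representation of a state by a unit vector in a Hilbert space. -/
theorem State.exists_rep (μ : State A) : ∃ (p : HilbertRep A) (Ω : p.H), ‖Ω‖ = 1 ∧
    ∀ a, μ.toLinearMap a = ⟪Ω, p.π a Ω⟫_ℂ := by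
  let _ : PartialOrder A := CStarAlgebra.spectralOrder A
  have _ : StarOrderedRing A := CStarAlgebra.spectralOrderedRing A
  let f : A →ₚ[ℂ] ℂ := PositiveLinearMap.mk₀ μ.toLinearMap fun a ha => by
    obtain ⟨b, rfl⟩ := CStarAlgebra.nonneg_iff_eq_star_mul_self.mp ha
    exact μ.nonneg b
  have hf : ∀ a, f a = μ.toLinearMap a := fun a => rfl
  refine ⟨⟨f.GNS, f.gnsStarAlgHom⟩, ((f.toPreGNS 1 : f.PreGNS) : Completion f.PreGNS), ?_, ?_⟩
  · refine (Completion.norm_coe _).trans ?_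
    rw [PositiveLinearMap.preGNS_norm_def]
    simp [hf, μ.map_one]
  · intro a
    change _ = ⟪_, f.gnsNonUnitalStarAlgHom a _⟫_ℂ
    rw [PositiveLinearMap.gnsNonUnitalStarAlgHom_apply_coe, Completion.inner_coe,
      PositiveLinearMap.preGNS_inner_def]
    simp [hf]

/-- The functional `μ ⊗ ν` on the algebraic tensor product. -/
def State.algProd (μ : State A) (ν : State B) : AlgTensor A B →ₗ[ℂ] ℂ :=
  (LinearMap.mul' ℂ ℂ ∘ₗ TensorProduct.map μ.toLinearMap ν.toLinearMap : A ⊗[ℂ] B →ₗ[ℂ] ℂ)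

theorem State.algProd_tmul (μ : State A) (ν : State B) (a : A) (b : B) :
    μ.algProd ν (AlgTensor.tmul a b) = μ.toLinearMap a * ν.toLinearMap b := rfl

theorem State.norm_algProd_le (μ : State A) (ν : State B) (t : AlgTensor A B) :
    ‖μ.algProd ν t‖ ≤ 1 * ‖t‖ := by
  obtain ⟨p, x, hx, hp⟩ := μ.exists_rep
  obtain ⟨q, y, hy, hq⟩ := ν.exists_rep
  have h : μ.algProd ν t
      = ⟪HilbertTensor.tmul x y, tensorRep p q t (HilbertTensor.tmul x y)⟫_ℂ := by
    induction t using AlgTensor.induction with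
    | h0 => simp
    | ha s t hs ht =>
      rw [map_add, map_add, add_apply, inner_add_right, hs, ht]
    | ht a b =>
      rw [State.algProd_tmul, tensorRep_tmul, opTensor_tmul, HilbertTensor.inner_tmul, hp, hq]
  have hxy : ‖HilbertTensor.tmul x y‖ = 1 := by
    have h2 := HilbertTensor.inner_tmul x x y y
    rw [inner_self_eq_norm_sq_to_K, inner_self_eq_norm_sq_to_K, inner_self_eq_norm_sq_to_K, hx,
      hy] at h2
    have h3 : ‖HilbertTensor.tmul x y‖ ^ 2 = 1 := by
      have h4 : ((‖HilbertTensor.tmul x y‖ ^ 2 : ℝ) : ℂ) = ((1 : ℝ) : ℂ) := by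
        push_cast
        simpa using h2
      exact_mod_cast h4
    exact (pow_eq_one_iff_of_nonneg (norm_nonneg _) two_ne_zero).mp h3
  rw [h]
  refine (norm_inner_le_norm _ _).trans ?_
  rw [hxy]
  refine mul_le_mul_of_nonneg_left ?_ zero_le_one
  refine (ContinuousLinearMap.le_opNorm _ _).trans ?_
  rw [hxy, mul_one]
  exact norm_tensorRep_le_spatialNorm p q t

/-- The product state `μ ⊗ ν` on the spatial tensor product, `a ⊗ b ↦ μ(a) ν(b)`. -/
def State.prod (μ : State A) (ν : State B) : SpatialTensor A B →L[ℂ] ℂ :=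
  ((μ.algProd ν).mkContinuous 1 (μ.norm_algProd_le ν)).fromCompletion

theorem State.prod_tmul (μ : State A) (ν : State B) (a : A) (b : B) :
    μ.prod ν (SpatialTensor.tmul a b) = μ.toLinearMap a * ν.toLinearMap b :=
  ContinuousLinearMap.fromCompletion_apply_coe _ _

end State

/-! ### Metric operator fields -/

section Mof

open SpatialTensor

variable {X : Type v} {A : X → Type u} [∀ x, CStarAlgebra (A x)]

/-- The *-morphism `A ⊗ C → A ⊗ B ⊗ C` that puts the unit in the middle, `a ⊗ c ↦ a ⊗ 1 ⊗ c`. -/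
def middle (A B C : Type u) [CStarAlgebra A] [CStarAlgebra B] [CStarAlgebra C] :
    SpatialTensor A C →⋆ₐ[ℂ] SpatialTensor (SpatialTensor A B) C :=
  SpatialTensor.map inl (StarAlgHom.id ℂ C)

/-- `t ↦ t ⊗ 1`, from `A ⊗ B` to `A ⊗ B ⊗ C`. -/
def onLeft (A B C : Type u) [CStarAlgebra A] [CStarAlgebra B] [CStarAlgebra C] :
    SpatialTensor A B →⋆ₐ[ℂ] SpatialTensor (SpatialTensor A B) C :=
  inl

/-- `t ↦ 1 ⊗ t`, from `B ⊗ C` to `A ⊗ B ⊗ C`. -/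
def onRight (A B C : Type u) [CStarAlgebra A] [CStarAlgebra B] [CStarAlgebra C] :
    SpatialTensor B C →⋆ₐ[ℂ] SpatialTensor (SpatialTensor A B) C :=
  SpatialTensor.map inr (StarAlgHom.id ℂ C)

/-- `D` is a metric operator field (mof) on the bundle `A` of unital C*-algebras. -/
structure IsMof (D : ∀ x x' : X, SpatialTensor (A x) (A x')) : Prop where
  exists_metricStates : ∃ μ : ∀ x, State (A x), ∀ x, (μ x).prod (μ x) (D x x) = 0
  nonneg : ∀ x x', x ≠ x' → 0 ≤ D x x'
  isUnit : ∀ x x', x ≠ x' → IsUnit (D x x')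
  symm : ∀ x x', D x x' = flip (D x' x)
  triangle : ∀ x x' x'', middle (A x) (A x') (A x'') (D x x'') ≤
    onLeft (A x) (A x') (A x'') (D x x') + onRight (A x) (A x') (A x'') (D x' x'')

/-- The mof `D` is central: `D x x' ∈ Z(A x) ⊗ Z(A x')`, the closed span in `A x ⊗ A x'` of the
elementary tensors of central elements. -/
def IsCentral (D : ∀ x x' : X, SpatialTensor (A x) (A x')) : Prop :=
  ∀ x x', D x x' ∈ closure (Submodule.span ℂ
    {t : SpatialTensor (A x) (A x') | ∃ a ∈ Set.center (A x), ∃ b ∈ Set.center (A x'),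
      t = tmul a b} : Set (SpatialTensor (A x) (A x')))

/-- `D` is bounded. -/
def IsBoundedMof (D : ∀ x x' : X, SpatialTensor (A x) (A x')) : Prop :=
  ∃ M : ℝ, ∀ x x', ‖D x x'‖ ≤ M

/-- `D` is bounded off the diagonal. -/
def IsBoundedOffDiag (D : ∀ x x' : X, SpatialTensor (A x) (A x')) : Prop :=
  ∃ M : ℝ, ∀ x x', x ≠ x' → ‖D x x'‖ ≤ M

/-- `D⁻¹` is bounded off the diagonal (where `D` is invertible). -/
def IsInvBoundedOffDiag (D : ∀ x x' : X, SpatialTensor (A x) (A x')) : Prop :=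
  ∃ M : ℝ, ∀ x x', x ≠ x' → ‖Ring.inverse (D x x')‖ ≤ M

open Classical in
/-- The function `D^{‖·‖}` on `X × X`. -/
def normDist (D : ∀ x x' : X, SpatialTensor (A x) (A x')) (x x' : X) : ℝ :=
  if x = x' then 0 else ‖D x x'‖

/-! ### Lipschitz operator fields -/

/-- `D_{x,x'}^{-1/2} (f(x) ⊗ 1 - 1 ⊗ f(x')) D_{x,x'}^{-1/2}`. -/
def diffQuot (D : ∀ x x' : X, SpatialTensor (A x) (A x')) (f : ∀ x, A x) (x x' : X) :
    SpatialTensor (A x) (A x') :=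
  D x x' ^ (-(1 / 2) : ℝ) * (inl (f x) - inr (f x')) * D x x' ^ (-(1 / 2) : ℝ)

/-- The Lipschitz seminorm `‖f‖_D`, which may be infinite. -/
def lipESeminorm (D : ∀ x x' : X, SpatialTensor (A x) (A x')) (f : ∀ x, A x) : ℝ≥0∞ :=
  ⨆ (x : X) (x' : X) (_ : x ≠ x'), ‖diffQuot D f x x'‖ₑ

/-- The Lipschitz seminorm `‖f‖_D` of a Lipschitz field, as a real number. -/
def lipSeminorm (D : ∀ x x' : X, SpatialTensor (A x) (A x')) (f : ∀ x, A x) : ℝ :=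
  (lipESeminorm D f).toReal

/-- The uniform norm `‖f‖_∞` of a bounded field. -/
def supNorm (f : ∀ x, A x) : ℝ := ⨆ x, ‖f x‖

/-- `‖f‖_Lip = ‖f‖_∞ + ‖f‖_D`. -/
def lipNorm (D : ∀ x x' : X, SpatialTensor (A x) (A x')) (f : ∀ x, A x) : ℝ :=
  supNorm f + lipSeminorm D f

theorem diffQuot_add (D : ∀ x x' : X, SpatialTensor (A x) (A x')) (f g : ∀ x, A x) (x x' : X) :
    diffQuot D (f + g) x x' = diffQuot D f x x' + diffQuot D g x x' := by
  simp only [diffQuot, Pi.add_apply, map_add]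
  noncomm_ring

theorem diffQuot_smul (D : ∀ x x' : X, SpatialTensor (A x) (A x')) (c : ℂ) (f : ∀ x, A x)
    (x x' : X) : diffQuot D (c • f) x x' = c • diffQuot D f x x' := by
  simp only [diffQuot, Pi.smul_apply, map_smul, ← smul_sub, mul_smul_comm, smul_mul_assoc]

theorem enorm_diffQuot_le (D : ∀ x x' : X, SpatialTensor (A x) (A x')) (f : ∀ x, A x) {x x' : X}
    (h : x ≠ x') : ‖diffQuot D f x x'‖ₑ ≤ lipESeminorm D f :=
  le_iSup_of_le x (le_iSup_of_le x' (le_iSup_of_le h le_rfl))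

theorem lipESeminorm_zero (D : ∀ x x' : X, SpatialTensor (A x) (A x')) :
    lipESeminorm D (0 : ∀ x, A x) = 0 := by
  simp [lipESeminorm, diffQuot]

theorem lipESeminorm_add_le (D : ∀ x x' : X, SpatialTensor (A x) (A x')) (f g : ∀ x, A x) :
    lipESeminorm D (f + g) ≤ lipESeminorm D f + lipESeminorm D g := by
  refine iSup_le fun x => iSup_le fun x' => iSup_le fun h => ?_
  rw [diffQuot_add]
  exact (enorm_add_le _ _).trans
    (add_le_add (enorm_diffQuot_le D f h) (enorm_diffQuot_le D g h))

theorem lipESeminorm_smul_le (D : ∀ x x' : X, SpatialTensor (A x) (A x')) (c : ℂ)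
    (f : ∀ x, A x) : lipESeminorm D (c • f) ≤ ‖c‖ₑ * lipESeminorm D f := by
  refine iSup_le fun x => iSup_le fun x' => iSup_le fun h => ?_
  rw [diffQuot_smul, enorm_smul]
  exact mul_le_mul_right (enorm_diffQuot_le D f h) _

variable (A) in
/-- `ℓ_∞`: the bounded operator fields. -/
def ellInfty : Submodule ℂ (∀ x, A x) where
  carrier := {f | Memℓp f ∞}
  zero_mem' := (zero_memℓp : Memℓp (0 : ∀ x, A x) ∞)
  add_mem' {f g} hf hg := Memℓp.add (f := f) (g := g) (p := ∞) hf hg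
  smul_mem' c f hf := Memℓp.const_smul (f := f) (p := ∞) hf c

/-- The Lipschitz operator fields (not necessarily bounded). -/
def lipschitzFields (D : ∀ x x' : X, SpatialTensor (A x) (A x')) : Submodule ℂ (∀ x, A x) where
  carrier := {f | lipESeminorm D f < ∞}
  zero_mem' := by
    rw [Set.mem_ofPred_eq, lipESeminorm_zero]
    exact ENNReal.zero_lt_top
  add_mem' hf hg := (lipESeminorm_add_le D _ _).trans_lt (ENNReal.add_lt_top.mpr ⟨hf, hg⟩)
  smul_mem' c _ hf := (lipESeminorm_smul_le D c _).trans_lt (ENNReal.mul_lt_top enorm_lt_top hf)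

/-- The operator fields that commute with `D`: `D x x'` commutes with `f x ⊗ 1` for all
`x, x'`. -/
def commutingFields (D : ∀ x x' : X, SpatialTensor (A x) (A x')) : Submodule ℂ (∀ x, A x) where
  carrier := {f | ∀ x x', Commute (D x x') (inl (f x))}
  zero_mem' x x' := by rw [Pi.zero_apply, map_zero]; exact Commute.zero_right _
  add_mem' hf hg x x' := by rw [Pi.add_apply, map_add]; exact (hf x x').add_right (hg x x')
  smul_mem' c _ hf x x' := by rw [Pi.smul_apply, map_smul]; exact (hf x x').smul_right c

variable (A) in
/-- The operator fields that vanish at `x₀`. -/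
def vanishingFields (x₀ : X) : Submodule ℂ (∀ x, A x) where
  carrier := {f | f x₀ = 0}
  zero_mem' := rfl
  add_mem' {f g} hf hg := by
    rw [Set.mem_ofPred_eq] at hf hg ⊢
    rw [Pi.add_apply, hf, hg, add_zero]
  smul_mem' c f hf := by
    rw [Set.mem_ofPred_eq] at hf ⊢
    rw [Pi.smul_apply, hf, smul_zero]

/-- The Lipschitz space `L(D)`: the bounded Lipschitz operator fields. -/
def L (D : ∀ x x' : X, SpatialTensor (A x) (A x')) : Submodule ℂ (∀ x, A x) :=
  ellInfty A ⊓ lipschitzFields D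

/-- `L_0(D)`: the Lipschitz operator fields that vanish at `x₀`. -/
def L₀ (D : ∀ x x' : X, SpatialTensor (A x) (A x')) (x₀ : X) : Submodule ℂ (∀ x, A x) :=
  lipschitzFields D ⊓ vanishingFields A x₀

/-- The Lipschitz algebra `Lip(D)`: the fields in `L(D)` that commute with `D`. -/
def Lip (D : ∀ x x' : X, SpatialTensor (A x) (A x')) : Submodule ℂ (∀ x, A x) :=
  L D ⊓ commutingFields D

/-- `Lip_0(D)`: the fields in `L_0(D)` that commute with `D`. -/
def Lip₀ (D : ∀ x x' : X, SpatialTensor (A x) (A x')) (x₀ : X) : Submodule ℂ (∀ x, A x) :=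
  L₀ D x₀ ⊓ commutingFields D

end Mof

/-! ### Banach spaces, Banach *-algebras and closed ideals -/

/-- The subspace `V` with the function `N` is a Banach space: `N` restricts to a norm on `V`, and
every `N`-Cauchy sequence in `V` converges in `V`. -/
structure IsBanachSpace {F : Type*} [AddCommGroup F] [Module ℂ F] (V : Submodule ℂ F)
    (N : F → ℝ) : Prop where
  nonneg : ∀ f ∈ V, 0 ≤ N f
  eq_zero_iff : ∀ f ∈ V, N f = 0 ↔ f = 0
  norm_smul : ∀ (c : ℂ), ∀ f ∈ V, N (c • f) = ‖c‖ * N f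
  norm_add_le : ∀ f ∈ V, ∀ g ∈ V, N (f + g) ≤ N f + N g
  complete : ∀ u : ℕ → F, (∀ n, u n ∈ V) →
    (∀ ε > 0, ∃ n₀, ∀ m ≥ n₀, ∀ n ≥ n₀, N (u m - u n) < ε) →
    ∃ f ∈ V, Filter.Tendsto (fun n => N (u n - f)) Filter.atTop (nhds 0)

/-- The subspace `V` of the *-algebra `F` with the function `N` is a unital Banach *-algebra (with
isometric involution) under the operations of `F`. -/
structure IsBanachStarAlgebra {F : Type*} [Ring F] [Algebra ℂ F] [StarRing F]
    (V : Submodule ℂ F) (N : F → ℝ) : Prop extends IsBanachSpace V N where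
  one_mem : 1 ∈ V
  mul_mem : ∀ f ∈ V, ∀ g ∈ V, f * g ∈ V
  star_mem : ∀ f ∈ V, star f ∈ V
  norm_mul_le : ∀ f ∈ V, ∀ g ∈ V, N (f * g) ≤ N f * N g
  norm_star : ∀ f ∈ V, N (star f) = N f

/-- `I` is a two-sided ideal of the algebra `V` which is closed for the norm `N` of `V`. -/
structure IsClosedIdeal {F : Type*} [Ring F] [Algebra ℂ F] (I V : Submodule ℂ F)
    (N : F → ℝ) : Prop where
  le : I ≤ V
  mul_mem_left : ∀ f ∈ V, ∀ g ∈ I, f * g ∈ I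
  mul_mem_right : ∀ f ∈ V, ∀ g ∈ I, g * f ∈ I
  closed : ∀ f ∈ V, (∀ ε > 0, ∃ g ∈ I, N (f - g) < ε) → f ∈ I

/-- `V` is closed under multiplication, and `V × V → V`, `(f, g) ↦ f * g`, is continuous for the
norm `N` of `V`. -/
def ContinuousMulOn {F : Type*} [Ring F] [Algebra ℂ F] (V : Submodule ℂ F) (N : F → ℝ) : Prop :=
  (∀ f ∈ V, ∀ g ∈ V, f * g ∈ V) ∧
    ∀ f ∈ V, ∀ g ∈ V, ∀ ε > 0, ∃ δ > 0, ∀ f' ∈ V, ∀ g' ∈ V,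
      N (f' - f) < δ → N (g' - g) < δ → N (f' * g' - f * g) < ε

end MOF
end

noncomputable section

namespace MOF

universe u v

/-! ### States separate the points of a C*-algebra -/

section States

variable {A : Type u} [CStarAlgebra A]

/-! Both norms are suprema of quantities that are continuous under pointwise convergence of fields:
`‖f x‖` and `‖diffQuot D f x x'‖`. Hence their balls are pointwise closed, and as soon as the norm
dominates every evaluation a Cauchy sequence has a pointwise limit, which is then its limit in norm
(`isBanachSpace_inf_of_pointwise`). For `lipNorm` this domination is clear. For `lipSeminorm` on
fields vanishing at `x₀` it comes from undoing the conjugation by `D^{-1/2}`: `‖f x‖ ≤ ‖D x x₀‖ *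
lipSeminorm D f` (`IsMof.norm_eval_le`). The same estimate gives `L₀ D x₀ ≤ L D` for bounded `D`.

When `f` and `g` commute with `D`, functional calculus moves `D^{-1/2}` past `f(x) ⊗ 1` and `1 ⊗
g(x')`, and the difference quotient becomes a derivation (`IsMof.diffQuot_mul`); this makes `Lip D`
an algebra with submultiplicative norm. Closure under the involution needs `D x x` to be
self-adjoint also on the diagonal, where positivity is not assumed. That is forced by the triangle
inequality at `x, x, x` together with flip symmetry (`IsMof.isSelfAdjoint_diag`).

If the inverses are bounded, the conjugation costs at most a constant, so `lipNorm` is equivalent to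
the supremum norm. For the metric, norms can be taken in the operator triangle inequality because
inserting a unit in the middle factor is isometric (`norm_middle`), and `1 ≤ ‖D‖ * ‖D⁻¹‖` separates
points. The existence of states keeps every algebra nonzero, which the isometry statements require.
For central `D` every field commutes with `D`, by density of the span of central elementary tensors.
-/

theorem exists_real_dual_pos_of_nonneg [PartialOrder A] [StarOrderedRing A] {b : A} (hb : 0 ≤ b)
    (hb0 : b ≠ 0) : ∃ f : StrongDual ℝ A, (∀ c, 0 ≤ c → 0 ≤ f c) ∧ 0 < f b := by
  have hnot : -b ∉ {a : A | 0 ≤ a} := fun h =>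
    hb0 (le_antisymm (neg_nonneg.mp h) hb)
  have hconv : Convex ℝ {a : A | 0 ≤ a} := convex_Ici (𝕜 := ℝ) (0 : A)
  obtain ⟨f, r, hr, hf⟩ :=
    geometric_hahn_banach_point_closed hconv CStarAlgebra.isClosed_nonneg hnot
  have hr0 : r < 0 := by simpa using hf 0 (le_refl (0 : A))
  refine ⟨f, fun c hc => ?_, ?_⟩
  -- A functional bounded below on a cone is nonnegative there: were `f c < 0`, the multiple of `c`
  -- by `r / f c` would lie in the cone and have value exactly `r`, which the separation forbids.
  · by_contra! hneg
    have h1 := hf ((r / f c) • c) (smul_nonneg (div_nonneg_of_nonpos hr0.le hneg.le) hc)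
    rw [map_smul, smul_eq_mul, div_mul_cancel₀ _ hneg.ne] at h1
    exact lt_irrefl _ h1
  · rw [map_neg] at hr
    linarith

/-- Hahn–Banach separation gives a positive real functional; complexifying and dividing by its value
at `1` turns it into a state. -/
theorem exists_state_ne_zero {a : A} (ha : a ≠ 0) :
    ∃ μ : State A, μ.toLinearMap (star a * a) ≠ 0 := by
  let _ : PartialOrder A := CStarAlgebra.spectralOrder A
  have _ : StarOrderedRing A := CStarAlgebra.spectralOrderedRing A
  have hb : 0 ≤ star a * a := star_mul_self_nonneg a
  obtain ⟨f, hf, hfb⟩ := exists_real_dual_pos_of_nonneg hb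
    fun h => ha (CStarRing.star_mul_self_eq_zero_iff a |>.mp h)
  -- Composing with the real part makes `fr` vanish on `i` times a self-adjoint element, so the
  -- complex extension `g` agrees with `f` on positive elements.
  let fr : Module.Dual ℝ A :=
    f.toLinearMap ∘ₗ (selfAdjoint.submodule ℝ A).subtype ∘ₗ realPart
  let g : A →ₗ[ℂ] ℂ := fr.extendRCLike
  have hg : ∀ c, 0 ≤ c → g c = (f c : ℂ) := fun c hc => by
    have hc' : IsSelfAdjoint c := hc.isSelfAdjoint
    have h1 : fr c = f c := congrArg f hc'.coe_realPart
    have h2 : fr (Complex.I • c) = 0 := by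
      change f ((realPart (Complex.I • c) : selfAdjoint A) : A) = 0
      rw [realPart_I_smul, hc'.imaginaryPart]
      simp
    change ((fr c : ℂ)) - Complex.I * ((fr (Complex.I • c) : ℝ) : ℂ) = _
    rw [h1, h2]
    simp
  -- The unit dominates a multiple of every positive element, so `f 1 = 0` would force `f (star a *
  -- a) ≤ 0`.
  have h1 : 0 < f 1 := by
    refine (hf 1 zero_le_one).lt_of_ne fun h => ?_
    have h2 : star a * a ≤ ‖star a * a‖ • (1 : A) := by
      rw [← Algebra.algebraMap_eq_smul_one]
      exact IsSelfAdjoint.le_algebraMap_norm_self hb.isSelfAdjoint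
    have h3 := hf _ (sub_nonneg.mpr h2)
    rw [map_sub, map_smul, ← h, smul_zero] at h3
    linarith
  refine ⟨⟨((f 1 : ℂ)⁻¹) • g, fun c => ?_, ?_⟩, ?_⟩
  · rw [LinearMap.smul_apply, hg _ (star_mul_self_nonneg c), smul_eq_mul, ← Complex.ofReal_inv,
      ← Complex.ofReal_mul]
    exact_mod_cast mul_nonneg (inv_nonneg.mpr h1.le) (hf _ (star_mul_self_nonneg c))
  · rw [LinearMap.smul_apply, hg _ zero_le_one, smul_eq_mul]
    exact inv_mul_cancel₀ (by exact_mod_cast h1.ne')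
  · rw [LinearMap.smul_apply, hg _ hb, smul_eq_mul]
    exact mul_ne_zero (inv_ne_zero (by exact_mod_cast h1.ne')) (by exact_mod_cast hfb.ne')

end States

/-! ### Embeddings of spatial tensor products -/

namespace SpatialTensor

open UniformSpace

variable {A B C E : Type u} [CStarAlgebra A] [CStarAlgebra B] [CStarAlgebra C] [CStarAlgebra E]

theorem continuous_starAlgHom {R : Type*} [CStarAlgebra R] (φ : SpatialTensor A B →⋆ₐ[ℂ] R) :
    Continuous φ :=
  AddMonoidHomClass.continuous_of_bound φ 1 fun t => by
    rw [one_mul]; exact NonUnitalStarAlgHom.norm_apply_le φ t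

theorem starAlgHom_ext {R : Type*} [CStarAlgebra R] {φ ψ : SpatialTensor A B →⋆ₐ[ℂ] R}
    (h : ∀ a b, φ (tmul a b) = ψ (tmul a b)) : φ = ψ := by
  refine StarAlgHom.ext fun x => ?_
  induction x using Completion.induction_on with
  | hp => exact isClosed_eq (continuous_starAlgHom φ) (continuous_starAlgHom ψ)
  | ih t =>
    induction t using AlgTensor.induction with
    | h0 => rw [Completion.coe_zero, map_zero, map_zero]
    | ht a b => exact h a b
    | ha s t hs ht => rw [Completion.coe_add, map_add, map_add, hs, ht]

theorem flip_inl (a : A) : flip (inl a : SpatialTensor A B) = inr a := flip_tmul a 1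

theorem flip_flip (x : SpatialTensor A B) : flip (flip x) = x :=
  DFunLike.congr_fun (starAlgHom_ext (φ := flip.comp flip) (ψ := StarAlgHom.id ℂ _) fun a b => by
    rw [StarAlgHom.comp_apply, flip_tmul, flip_tmul]
    rfl) x

theorem flip_injective : Function.Injective (flip : SpatialTensor A B →⋆ₐ[ℂ] SpatialTensor B A) :=
  Function.LeftInverse.injective flip_flip

theorem norm_flip (x : SpatialTensor A B) : ‖flip x‖ = ‖x‖ :=
  NonUnitalStarAlgHom.norm_map _ flip_injective x

/-- A product state `μ ⊗ ν` recovers `μ` on the first leg, and states `μ` separate points. The state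
`ν` excludes `B = 0`, for which the map would be zero. -/
theorem inl_injective (ν : State B) :
    Function.Injective (inl : A →⋆ₐ[ℂ] SpatialTensor A B) := by
  refine (injective_iff_map_eq_zero _).mpr fun a ha => ?_
  by_contra hne
  obtain ⟨μ, hμ⟩ := exists_state_ne_zero hne
  have h : μ.prod ν (inl (star a * a)) = μ.toLinearMap (star a * a) := by
    refine (μ.prod_tmul ν _ _).trans ?_
    rw [ν.map_one, mul_one]
  rw [map_mul, ha, mul_zero, map_zero] at h
  exact hμ h.symm

theorem norm_inl (ν : State B) (a : A) : ‖(inl a : SpatialTensor A B)‖ = ‖a‖ :=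
  NonUnitalStarAlgHom.norm_map _ (inl_injective ν) a

theorem norm_inl_le (a : A) : ‖(inl a : SpatialTensor A B)‖ ≤ ‖a‖ :=
  NonUnitalStarAlgHom.norm_apply_le inl a

theorem norm_inr_le (b : B) : ‖(inr b : SpatialTensor A B)‖ ≤ ‖b‖ :=
  NonUnitalStarAlgHom.norm_apply_le inr b

theorem nontrivial (μ : State A) (ν : State B) : Nontrivial (SpatialTensor A B) :=
  ⟨1, 0, fun h => by
    have h1 : μ.prod ν 1 = 1 := by
      refine (μ.prod_tmul ν 1 1).trans ?_
      rw [μ.map_one, ν.map_one, mul_one]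
    rw [h, map_zero] at h1
    exact zero_ne_one h1⟩

theorem inl_mul_inr (a : A) (b : B) : inl a * inr b = tmul a b := by
  change ((_ : AlgTensor A B) : SpatialTensor A B) * (_ : AlgTensor A B) = (_ : AlgTensor A B)
  rw [← Completion.coe_mul]
  refine congrArg _ ?_
  refine (Algebra.TensorProduct.tmul_mul_tmul a 1 1 b).trans ?_
  rw [mul_one, one_mul]
  rfl

theorem inr_mul_inl (a : A) (b : B) : inr b * inl a = tmul a b := by
  change ((_ : AlgTensor A B) : SpatialTensor A B) * (_ : AlgTensor A B) = (_ : AlgTensor A B)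
  rw [← Completion.coe_mul]
  refine congrArg _ ?_
  refine (Algebra.TensorProduct.tmul_mul_tmul 1 a b 1).trans ?_
  rw [mul_one, one_mul]
  rfl

theorem commute_inl_inr (a : A) (b : B) : Commute (inl a : SpatialTensor A B) (inr b) :=
  (inl_mul_inr a b).trans (inr_mul_inl a b).symm

/-- A contractive *-homomorphism from the algebraic tensor product to a C*-algebra extends to the
spatial tensor product. -/
def lift {R : Type u} [CStarAlgebra R] (φ : AlgTensor A B →⋆ₐ[ℂ] R) (hφ : ∀ t, ‖φ t‖ ≤ ‖t‖) :
    SpatialTensor A B →⋆ₐ[ℂ] R :=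
  have hc : Continuous (φ : AlgTensor A B →+* R) :=
    AddMonoidHomClass.continuous_of_bound φ 1 fun t => by rw [one_mul]; exact hφ t
  have h : ∀ t : AlgTensor A B, Completion.extension φ (t : SpatialTensor A B) = φ t :=
    Completion.extensionHom_coe (φ : AlgTensor A B →+* R) hc
  { Completion.extensionHom (φ : AlgTensor A B →+* R) hc with
    commutes' := fun r => (h (algebraMap ℂ (AlgTensor A B) r)).trans (φ.commutes' r)
    map_star' := fun x => by
      change Completion.extension φ (star x) = star (Completion.extension φ x)
      induction x using Completion.induction_on with
      | hp =>
        exact isClosed_eq (Completion.continuous_extension.comp continuous_star')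
          (continuous_star.comp Completion.continuous_extension)
      | ih t => rw [star_coe, h, h, map_star] }

theorem lift_coe {R : Type u} [CStarAlgebra R] (φ : AlgTensor A B →⋆ₐ[ℂ] R)
    (hφ : ∀ t, ‖φ t‖ ≤ ‖t‖) (t : AlgTensor A B) : lift φ hφ (t : SpatialTensor A B) = φ t :=
  have hc : Continuous (φ : AlgTensor A B →+* R) :=
    AddMonoidHomClass.continuous_of_bound φ 1 fun t => by rw [one_mul]; exact hφ t
  Completion.extensionHom_coe (φ : AlgTensor A B →+* R) hc t

end SpatialTensor

/-- The representation `π ⊗ ρ` of the spatial tensor product. -/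
def HilbertRep.prod {A B : Type u} [CStarAlgebra A] [CStarAlgebra B] (p : HilbertRep A)
    (q : HilbertRep B) : HilbertRep (SpatialTensor A B) where
  H := HilbertTensor p.H q.H
  π := SpatialTensor.lift (tensorRep p q) (norm_tensorRep_le_spatialNorm p q)

theorem HilbertRep.prod_π_tmul {A B : Type u} [CStarAlgebra A] [CStarAlgebra B] (p : HilbertRep A)
    (q : HilbertRep B) (a : A) (b : B) :
    (p.prod q).π (SpatialTensor.tmul a b) = opTensor (p.π a) (q.π b) :=
  (SpatialTensor.lift_coe _ (norm_tensorRep_le_spatialNorm p q) _).trans (tensorRep_tmul p q a b)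

/-! ### Inserting a unit in the middle factor is isometric -/

section Middle

variable {H K G : Type u} [NormedAddCommGroup H] [InnerProductSpace ℂ H]
  [NormedAddCommGroup K] [InnerProductSpace ℂ K] [NormedAddCommGroup G] [InnerProductSpace ℂ G]

theorem HilbertTensor.norm_tmul (h : H) (k : K) : ‖HilbertTensor.tmul h k‖ = ‖h‖ * ‖k‖ :=
  (UniformSpace.Completion.norm_coe _).trans (TensorProduct.norm_tmul h k)

/-- The isometry `h ↦ h ⊗ k` for a unit vector `k`. -/
def HilbertTensor.rightUnit (k : K) (hk : ‖k‖ = 1) : H →ₗᵢ[ℂ] HilbertTensor H K where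
  toFun h := HilbertTensor.tmul h k
  map_add' h h' := HilbertTensor.add_tmul h h' k
  map_smul' c h := HilbertTensor.smul_tmul c h k
  norm_map' h := by
    change ‖HilbertTensor.tmul h k‖ = _
    rw [HilbertTensor.norm_tmul, hk, mul_one]

/-- The map `h ⊗ g ↦ U h ⊗ g` for an isometry `U`. -/
def HilbertTensor.mapLeft (U : H →ₗᵢ[ℂ] K) : HilbertTensor H G →L[ℂ] HilbertTensor K G :=
  (TensorProduct.mapIsometry U (LinearIsometry.id (R := ℂ) (E := G))).toContinuousLinearMap.completion

theorem HilbertTensor.mapLeft_tmul (U : H →ₗᵢ[ℂ] K) (h : H) (g : G) :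
    HilbertTensor.mapLeft U (HilbertTensor.tmul h g) = HilbertTensor.tmul (U h) g :=
  ContinuousLinearMap.completion_apply_coe
    (TensorProduct.mapIsometry U (LinearIsometry.id (R := ℂ) (E := G))).toContinuousLinearMap
    (h ⊗ₜ[ℂ] g)

theorem HilbertTensor.norm_mapLeft (U : H →ₗᵢ[ℂ] K) (x : HilbertTensor H G) :
    ‖HilbertTensor.mapLeft U x‖ = ‖x‖ := by
  refine UniformSpace.Completion.induction_on (α := H ⊗[ℂ] G)
    (p := fun x : HilbertTensor H G => ‖HilbertTensor.mapLeft U x‖ = ‖x‖) x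
    (isClosed_eq (HilbertTensor.mapLeft U).continuous.norm continuous_norm) fun y => ?_
  refine (congrArg norm (ContinuousLinearMap.completion_apply_coe (TensorProduct.mapIsometry U
    (LinearIsometry.id (R := ℂ) (E := G))).toContinuousLinearMap y)).trans ?_
  refine (UniformSpace.Completion.norm_coe _).trans ?_
  refine ((TensorProduct.mapIsometry U (LinearIsometry.id (R := ℂ) (E := G))).norm_map y).trans ?_
  exact (UniformSpace.Completion.norm_coe (E := H ⊗[ℂ] G) y).symm

variable {A B C : Type u} [CStarAlgebra A] [CStarAlgebra B] [CStarAlgebra C]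

/-- The GNS representation `r` of `ν` supplies a unit vector `k`, and `h ↦ h ⊗ k` intertwines `p`
with the restriction of `p ⊗ r` to `A ⊗ 1`. Thus `p ⊗ q` sits isometrically inside a representation
that factors through `a ⊗ c ↦ a ⊗ 1 ⊗ c`, and its norm cannot exceed that of the image. -/
theorem norm_tensorRep_le_norm_algMap_inl (ν : State B) (p : HilbertRep A) (q : HilbertRep C)
    (t : AlgTensor A C) :
    ‖tensorRep p q t‖ ≤
      ‖SpatialTensor.algMap (SpatialTensor.inl : A →⋆ₐ[ℂ] SpatialTensor A B)
        (StarAlgHom.id ℂ C) t‖ := by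
  obtain ⟨r, k, hk, -⟩ := ν.exists_rep
  set φ := SpatialTensor.algMap (SpatialTensor.inl : A →⋆ₐ[ℂ] SpatialTensor A B)
    (StarAlgHom.id ℂ C) with hφ
  let U : p.H →ₗᵢ[ℂ] (p.prod r).H := HilbertTensor.rightUnit k hk
  have hU : ∀ a x, (p.prod r).π (SpatialTensor.inl a) (U x) = U (p.π a x) := fun a x => by
    refine (congrArg (fun S => S (U x)) (HilbertRep.prod_π_tmul p r a 1)).trans ?_
    refine (opTensor_tmul _ _ _ _).trans ?_
    rw [map_one]
    rfl
  let V : HilbertTensor p.H q.H →L[ℂ] HilbertTensor (p.prod r).H q.H := HilbertTensor.mapLeft U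
  have hV : ∀ x, ‖V x‖ = ‖x‖ := HilbertTensor.norm_mapLeft _
  have h : ∀ x, tensorRep (p.prod r) q (φ t) (V x) = V (tensorRep p q t x) := by
    intro x
    induction t using AlgTensor.induction with
    | h0 => simp only [map_zero, zero_apply]
    | ha s t hs ht => simp only [map_add, add_apply, hs, ht]
    | ht a c =>
      rw [hφ, SpatialTensor.algMap_tmul, tensorRep_tmul, tensorRep_tmul]
      induction x using HilbertTensor.induction with
      | hc => exact isClosed_eq (by fun_prop) (by fun_prop)
      | h0 => simp only [map_zero]
      | ha x y hx hy => simp only [map_add, hx, hy]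
      | ht x y =>
        rw [HilbertTensor.mapLeft_tmul, opTensor_tmul, opTensor_tmul, HilbertTensor.mapLeft_tmul, hU]
        rfl
  refine ContinuousLinearMap.opNorm_le_bound _ (norm_nonneg _) fun x => ?_
  rw [← hV, ← h, ← hV x]
  exact (ContinuousLinearMap.le_opNorm _ _).trans (mul_le_mul_of_nonneg_right
    (norm_tensorRep_le_spatialNorm _ _ _) (norm_nonneg _))

theorem norm_middle (ν : State B) (x : SpatialTensor A C) : ‖middle A B C x‖ = ‖x‖ := by
  induction x using UniformSpace.Completion.induction_on with
  | hp => exact isClosed_eq (map_continuous (middle A B C)).norm continuous_norm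
  | ih t =>
    refine (congrArg norm (SpatialTensor.extendHom_coe _ (SpatialTensor.norm_algMap_le _ _) t)).trans ?_
    rw [UniformSpace.Completion.norm_coe, UniformSpace.Completion.norm_coe]
    exact le_antisymm (SpatialTensor.norm_algMap_le _ _ t)
      (spatialNorm_le (norm_nonneg _) fun p q => norm_tensorRep_le_norm_algMap_inl ν p q t)

end Middle


/-! ### Banach spaces of operator fields -/

section Pointwise

open Filter Topology

variable {X : Type v} {A : X → Type u} [∀ x, CStarAlgebra (A x)]

/-- A space of operator fields is a Banach space for a norm that dominates the evaluations and
whose balls are sequentially closed under pointwise convergence; so is its intersection with any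
pointwise closed subspace. -/
theorem isBanachSpace_inf_of_pointwise {V W : Submodule ℂ (∀ x, A x)} {N : (∀ x, A x) → ℝ}
    (hW : IsClosed (W : Set (∀ x, A x)))
    (norm_smul : ∀ (c : ℂ), ∀ f ∈ V, N (c • f) = ‖c‖ * N f)
    (norm_add_le : ∀ f ∈ V, ∀ g ∈ V, N (f + g) ≤ N f + N g)
    (nonneg : ∀ f ∈ V, 0 ≤ N f)
    (eval_le : ∀ x, ∃ C, ∀ f ∈ V, ‖f x‖ ≤ C * N f)
    (closed : ∀ (u : ℕ → ∀ x, A x) (f : ∀ x, A x) (C : ℝ), (∀ n, u n ∈ V) → (∀ n, N (u n) ≤ C) →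
      Tendsto u atTop (𝓝 f) → f ∈ V ∧ N f ≤ C) : IsBanachSpace (V ⊓ W) N where
  nonneg f hf := nonneg f hf.1
  eq_zero_iff f hf := by
    constructor
    · intro h
      funext x
      obtain ⟨C, hC⟩ := eval_le x
      have h1 := hC f hf.1
      rw [h, mul_zero] at h1
      exact norm_le_zero_iff.mp h1
    · rintro rfl
      have h := norm_smul 0 0 V.zero_mem
      rwa [zero_smul, norm_zero, zero_mul] at h
  norm_smul c f hf := norm_smul c f hf.1
  norm_add_le f hf g hg := norm_add_le f hf.1 g hg.1
  complete u hu hc := by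
    have hlim : ∀ x, ∃ a, Tendsto (fun n => u n x) atTop (𝓝 a) := fun x => by
      refine cauchySeq_tendsto_of_complete (Metric.cauchySeq_iff.mpr fun ε hε => ?_)
      obtain ⟨C, hC⟩ := eval_le x
      -- The constant `C` has no prescribed sign, so a positive majorant is needed for the division.
      have hC1 : (0 : ℝ) < |C| + 1 := by positivity
      obtain ⟨n₀, hn₀⟩ := hc (ε / (|C| + 1)) (by positivity)
      refine ⟨n₀, fun m hm n hn => ?_⟩
      have hmn := V.sub_mem (hu m).1 (hu n).1
      rw [dist_eq_norm]
      calc ‖u m x - u n x‖ ≤ C * N (u m - u n) := hC _ hmn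
        _ ≤ (|C| + 1) * N (u m - u n) :=
          mul_le_mul_of_nonneg_right (by linarith [le_abs_self C]) (nonneg _ hmn)
        _ < (|C| + 1) * (ε / (|C| + 1)) := mul_lt_mul_of_pos_left (hn₀ m hm n hn) hC1
        _ = ε := mul_div_cancel₀ _ hC1.ne'
    choose f hf using hlim
    have htend : Tendsto u atTop (𝓝 f) := tendsto_pi_nhds.mpr hf
    -- For fixed `n` the differences `u m - u n` stay in the `ε`-ball and converge pointwise to `f -
    -- u n`, so closedness of the ball puts the limit there.
    have hsub : ∀ ε > 0, ∃ n₀, ∀ n ≥ n₀, f - u n ∈ V ∧ N (f - u n) ≤ ε := fun ε hε => by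
      obtain ⟨n₀, hn₀⟩ := hc ε hε
      refine ⟨n₀, fun n hn => closed (fun m => u (m + n₀) - u n) _ ε
        (fun m => V.sub_mem (hu _).1 (hu n).1)
        (fun m => (hn₀ _ (Nat.le_add_left _ _) n hn).le) ?_⟩
      exact ((tendsto_add_atTop_iff_nat n₀).mpr htend).sub_const _
    have hfV : f ∈ V := by
      obtain ⟨n₀, hn₀⟩ := hsub 1 one_pos
      have h := V.add_mem (hn₀ n₀ le_rfl).1 (hu n₀).1
      rwa [sub_add_cancel] at h
    refine ⟨f, ⟨hfV, hW.mem_of_tendsto htend (Eventually.of_forall fun n => (hu n).2)⟩, ?_⟩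
    refine Metric.tendsto_atTop.mpr fun ε hε => ?_
    obtain ⟨n₀, hn₀⟩ := hsub (ε / 2) (half_pos hε)
    refine ⟨n₀, fun n hn => ?_⟩
    have h1 : N (u n - f) = N (f - u n) := by
      have h := norm_smul (-1) _ (hn₀ n hn).1
      rwa [neg_one_smul, neg_sub, norm_neg, norm_one, one_mul] at h
    rw [Real.dist_eq, sub_zero, h1, abs_of_nonneg (nonneg _ (hn₀ n hn).1)]
    linarith [(hn₀ n hn).2]

end Pointwise

/-! ### Powers of positive invertible elements -/

section Rpow

variable {R : Type u} [CStarAlgebra R] [PartialOrder R] [StarOrderedRing R]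

theorem norm_rpow_neg_half_mul_self {a : R} (ha : IsStrictlyPositive a) :
    ‖a ^ (-(1 / 2) : ℝ)‖ * ‖a ^ (-(1 / 2) : ℝ)‖ = ‖Ring.inverse a‖ := by
  have hsa : IsSelfAdjoint (a ^ (-(1 / 2) : ℝ)) := CFC.rpow_nonneg.isSelfAdjoint
  rw [CFC.inverse_eq_rpow_neg_one ha, ← CStarRing.norm_star_mul_self, hsa.star_eq,
    ← CFC.rpow_add ha.isUnit]
  norm_num

theorem norm_rpow_half_mul_self {a : R} (ha : IsStrictlyPositive a) :
    ‖a ^ (1 / 2 : ℝ)‖ * ‖a ^ (1 / 2 : ℝ)‖ = ‖a‖ := by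
  have hsa : IsSelfAdjoint (a ^ (1 / 2 : ℝ)) := CFC.rpow_nonneg.isSelfAdjoint
  rw [← CStarRing.norm_star_mul_self, hsa.star_eq, ← CFC.rpow_add ha.isUnit]
  norm_num [CFC.rpow_one a ha.nonneg]

theorem norm_rpow_neg_half_conj_le {a : R} (ha : IsStrictlyPositive a) (b : R) :
    ‖a ^ (-(1 / 2) : ℝ) * b * a ^ (-(1 / 2) : ℝ)‖ ≤ ‖Ring.inverse a‖ * ‖b‖ := by
  rw [← norm_rpow_neg_half_mul_self ha]
  refine (norm_mul_le _ _).trans ((mul_le_mul_of_nonneg_right (norm_mul_le _ _)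
    (norm_nonneg _)).trans (le_of_eq (by ring)))

/-- Conjugating by `a^{1/2}` undoes the conjugation by `a^{-1/2}`, and `‖a^{1/2}‖² = ‖a‖`. -/
theorem norm_le_norm_rpow_neg_half_conj {a : R} (ha : IsStrictlyPositive a) (b : R) :
    ‖b‖ ≤ ‖a‖ * ‖a ^ (-(1 / 2) : ℝ) * b * a ^ (-(1 / 2) : ℝ)‖ := by
  set c := a ^ (-(1 / 2) : ℝ) * b * a ^ (-(1 / 2) : ℝ) with hc
  have h : b = a ^ (1 / 2 : ℝ) * c * a ^ (1 / 2 : ℝ) := by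
    calc b = (a ^ (1 / 2 : ℝ) * a ^ (-(1 / 2) : ℝ)) * b *
          (a ^ (-(1 / 2) : ℝ) * a ^ (1 / 2 : ℝ)) := by
          rw [CFC.rpow_mul_rpow_neg _ ha, CFC.rpow_neg_mul_rpow _ ha, one_mul, mul_one]
      _ = _ := by simp only [hc, mul_assoc]
  rw [← norm_rpow_half_mul_self ha]
  calc ‖b‖ = ‖a ^ (1 / 2 : ℝ) * c * a ^ (1 / 2 : ℝ)‖ := congrArg norm h
    _ ≤ ‖a ^ (1 / 2 : ℝ)‖ * ‖c‖ * ‖a ^ (1 / 2 : ℝ)‖ :=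
      (norm_mul_le _ _).trans (mul_le_mul_of_nonneg_right (norm_mul_le _ _) (norm_nonneg _))
    _ = _ := by ring

end Rpow

/-! ### The norms of operator fields -/

section Norms

open SpatialTensor Filter Topology

variable {X : Type v} {A : X → Type u} [∀ x, CStarAlgebra (A x)]
  {D : ∀ x x' : X, SpatialTensor (A x) (A x')} {f g : ∀ x, A x}

theorem mem_ellInfty_iff : f ∈ ellInfty A ↔ BddAbove (Set.range fun x => ‖f x‖) :=
  memℓp_infty_iff

theorem supNorm_nonneg (f : ∀ x, A x) : 0 ≤ supNorm f := Real.iSup_nonneg fun _ => norm_nonneg _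

theorem norm_le_supNorm (hf : f ∈ ellInfty A) (x : X) : ‖f x‖ ≤ supNorm f :=
  le_ciSup (mem_ellInfty_iff.mp hf) x

theorem supNorm_le {C : ℝ} (hC : 0 ≤ C) (h : ∀ x, ‖f x‖ ≤ C) : supNorm f ≤ C :=
  Real.iSup_le h hC

theorem mem_ellInfty_of_norm_le {C : ℝ} (h : ∀ x, ‖f x‖ ≤ C) : f ∈ ellInfty A :=
  mem_ellInfty_iff.mpr ⟨C, by rintro _ ⟨x, rfl⟩; exact h x⟩

theorem supNorm_smul (c : ℂ) (f : ∀ x, A x) : supNorm (c • f) = ‖c‖ * supNorm f := by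
  simp only [supNorm, Pi.smul_apply, norm_smul, Real.mul_iSup_of_nonneg (norm_nonneg c)]

theorem supNorm_add_le (hf : f ∈ ellInfty A) (hg : g ∈ ellInfty A) :
    supNorm (f + g) ≤ supNorm f + supNorm g :=
  supNorm_le (add_nonneg (supNorm_nonneg f) (supNorm_nonneg g)) fun x =>
    (norm_add_le _ _).trans (add_le_add (norm_le_supNorm hf x) (norm_le_supNorm hg x))

theorem norm_mul_le_supNorm (hf : f ∈ ellInfty A) (hg : g ∈ ellInfty A) (x : X) :
    ‖(f * g) x‖ ≤ supNorm f * supNorm g :=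
  (norm_mul_le _ _).trans (mul_le_mul (norm_le_supNorm hf x) (norm_le_supNorm hg x)
    (norm_nonneg _) (supNorm_nonneg f))

theorem mul_mem_ellInfty (hf : f ∈ ellInfty A) (hg : g ∈ ellInfty A) : f * g ∈ ellInfty A :=
  mem_ellInfty_of_norm_le (norm_mul_le_supNorm hf hg)

theorem supNorm_mul_le (hf : f ∈ ellInfty A) (hg : g ∈ ellInfty A) :
    supNorm (f * g) ≤ supNorm f * supNorm g :=
  supNorm_le (mul_nonneg (supNorm_nonneg f) (supNorm_nonneg g)) (norm_mul_le_supNorm hf hg)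

theorem lipSeminorm_nonneg (D : ∀ x x' : X, SpatialTensor (A x) (A x')) (f : ∀ x, A x) :
    0 ≤ lipSeminorm D f := ENNReal.toReal_nonneg

theorem norm_diffQuot_le_lipSeminorm (hf : f ∈ lipschitzFields D) {x x' : X} (h : x ≠ x') :
    ‖diffQuot D f x x'‖ ≤ lipSeminorm D f := by
  rw [← toReal_enorm]
  exact ENNReal.toReal_mono (ne_of_lt hf) (enorm_diffQuot_le D f h)

theorem lipESeminorm_le {C : ℝ} (h : ∀ x x', x ≠ x' → ‖diffQuot D f x x'‖ ≤ C) :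
    lipESeminorm D f ≤ ENNReal.ofReal C :=
  iSup_le fun x => iSup_le fun x' => iSup_le fun hx => by
    rw [← ofReal_norm]
    exact ENNReal.ofReal_le_ofReal (h x x' hx)

theorem mem_lipschitzFields {C : ℝ} (h : ∀ x x', x ≠ x' → ‖diffQuot D f x x'‖ ≤ C) :
    f ∈ lipschitzFields D :=
  (lipESeminorm_le h).trans_lt ENNReal.ofReal_lt_top

theorem lipSeminorm_le {C : ℝ} (hC : 0 ≤ C) (h : ∀ x x', x ≠ x' → ‖diffQuot D f x x'‖ ≤ C) :
    lipSeminorm D f ≤ C :=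
  ENNReal.toReal_le_of_le_ofReal hC (lipESeminorm_le h)

theorem lipSeminorm_smul (D : ∀ x x' : X, SpatialTensor (A x) (A x')) (c : ℂ) (f : ∀ x, A x) :
    lipSeminorm D (c • f) = ‖c‖ * lipSeminorm D f := by
  have h : lipESeminorm D (c • f) = ‖c‖ₑ * lipESeminorm D f := by
    simp only [lipESeminorm, diffQuot_smul, enorm_smul, ENNReal.mul_iSup]
  rw [lipSeminorm, h, ENNReal.toReal_mul, toReal_enorm, lipSeminorm]

theorem lipSeminorm_add_le (hf : f ∈ lipschitzFields D) (hg : g ∈ lipschitzFields D) :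
    lipSeminorm D (f + g) ≤ lipSeminorm D f + lipSeminorm D g :=
  ENNReal.toReal_le_add (lipESeminorm_add_le D f g) (ne_of_lt hf) (ne_of_lt hg)

theorem lipNorm_nonneg (D : ∀ x x' : X, SpatialTensor (A x) (A x')) (f : ∀ x, A x) :
    0 ≤ lipNorm D f := add_nonneg (supNorm_nonneg f) (lipSeminorm_nonneg D f)

theorem lipNorm_smul (D : ∀ x x' : X, SpatialTensor (A x) (A x')) (c : ℂ) (f : ∀ x, A x) :
    lipNorm D (c • f) = ‖c‖ * lipNorm D f := by
  rw [lipNorm, supNorm_smul, lipSeminorm_smul, lipNorm, mul_add]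

theorem lipNorm_add_le (hf : f ∈ L D) (hg : g ∈ L D) :
    lipNorm D (f + g) ≤ lipNorm D f + lipNorm D g := by
  have h1 := supNorm_add_le hf.1 hg.1
  have h2 := lipSeminorm_add_le hf.2 hg.2
  simp only [lipNorm]
  linarith

theorem supNorm_le_lipNorm (D : ∀ x x' : X, SpatialTensor (A x) (A x')) (f : ∀ x, A x) :
    supNorm f ≤ lipNorm D f := le_add_of_nonneg_right (lipSeminorm_nonneg D f)

theorem continuous_inl (x x' : X) :
    Continuous (inl : A x → SpatialTensor (A x) (A x')) :=
  AddMonoidHomClass.continuous_of_bound (inl : A x →⋆ₐ[ℂ] SpatialTensor (A x) (A x')) 1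
    fun a => by rw [one_mul]; exact norm_inl_le a

theorem continuous_inr (x x' : X) :
    Continuous (inr : A x' → SpatialTensor (A x) (A x')) :=
  AddMonoidHomClass.continuous_of_bound (inr : A x' →⋆ₐ[ℂ] SpatialTensor (A x) (A x')) 1
    fun a => by rw [one_mul]; exact norm_inr_le a

theorem continuous_diffQuot (D : ∀ x x' : X, SpatialTensor (A x) (A x')) (x x' : X) :
    Continuous fun f : ∀ x, A x => diffQuot D f x x' :=
  (continuous_const.mul (((continuous_inl x x').comp (continuous_apply x)).sub
    ((continuous_inr x x').comp (continuous_apply x')))).mul continuous_const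

theorem isClosed_commutingFields (D : ∀ x x' : X, SpatialTensor (A x) (A x')) :
    IsClosed (commutingFields D : Set (∀ x, A x)) := by
  have h : (commutingFields D : Set (∀ x, A x))
      = ⋂ x, ⋂ x', {f | D x x' * inl (f x) = inl (f x) * D x x'} := by
    ext f
    simp only [Set.mem_iInter]
    rfl
  rw [h]
  refine isClosed_iInter fun x => isClosed_iInter fun x' => ?_
  have hc := (continuous_inl (A := A) x x').comp (continuous_apply x)
  exact isClosed_eq (continuous_const.mul hc) (hc.mul continuous_const)

/-- The closed subspace `W` lets one argument serve both `L D` (with `W = ⊤`) and `Lip D` (with `W`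
the commuting fields). -/
theorem isBanachSpace_L_inf {W : Submodule ℂ (∀ x, A x)} (hW : IsClosed (W : Set (∀ x, A x))) :
    IsBanachSpace (L D ⊓ W) (lipNorm D) := by
  refine isBanachSpace_inf_of_pointwise hW (fun c f _ => lipNorm_smul D c f)
    (fun f hf g hg => lipNorm_add_le hf hg) (fun f _ => lipNorm_nonneg D f)
    (fun x => ⟨1, fun f hf => ?_⟩) fun u f C hu hC hlim => ?_
  · rw [one_mul]
    exact (norm_le_supNorm hf.1 x).trans (supNorm_le_lipNorm D f)
  · have hC0 : 0 ≤ C := (lipNorm_nonneg D _).trans (hC 0)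
    have hx : ∀ x, Tendsto (fun n => ‖u n x‖) atTop (𝓝 ‖f x‖) := fun x =>
      (tendsto_pi_nhds.mp hlim x).norm
    have hq : ∀ x x', Tendsto (fun n => ‖diffQuot D (u n) x x'‖) atTop
        (𝓝 ‖diffQuot D f x x'‖) := fun x x' =>
      (((continuous_diffQuot D x x').tendsto f).comp hlim).norm
    have h1 : ∀ x, ‖f x‖ ≤ C := fun x => le_of_tendsto' (hx x) fun n =>
      ((norm_le_supNorm (hu n).1 x).trans (supNorm_le_lipNorm D _)).trans (hC n)
    have h2 : ∀ y y', y ≠ y' → ‖diffQuot D f y y'‖ ≤ C := fun y y' hy =>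
      le_of_tendsto' (hq y y') fun n => ((norm_diffQuot_le_lipSeminorm (hu n).2 hy).trans
        (le_add_of_nonneg_left (supNorm_nonneg _))).trans (hC n)
    -- The sum of one value and one quotient is passed to the limit before either supremum is taken;
    -- bounding the two suprema separately would give only `2 * C`.
    have h3 : ∀ y y', y ≠ y' → ∀ x, ‖f x‖ ≤ C - ‖diffQuot D f y y'‖ := fun y y' hy x => by
      rw [le_sub_iff_add_le]
      exact le_of_tendsto' ((hx x).add (hq y y')) fun n => (add_le_add
        (norm_le_supNorm (hu n).1 x) (norm_diffQuot_le_lipSeminorm (hu n).2 hy)).trans (hC n)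
    have h4 : lipSeminorm D f ≤ C - supNorm f := by
      refine lipSeminorm_le (sub_nonneg.mpr (supNorm_le hC0 h1)) fun y y' hy => ?_
      rw [le_sub_comm]
      exact supNorm_le (sub_nonneg.mpr (h2 y y' hy)) (h3 y y' hy)
    refine ⟨⟨mem_ellInfty_of_norm_le h1, mem_lipschitzFields h2⟩, ?_⟩
    rw [lipNorm]
    linarith

/-! ### The involution on Lipschitz fields -/

theorem star_diffQuot (f : ∀ x, A x) (x x' : X) :
    diffQuot D (star f) x x' = star (diffQuot D f x x') := by
  have hsa : star (D x x' ^ (-(1 / 2) : ℝ)) = D x x' ^ (-(1 / 2) : ℝ) :=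
    CFC.rpow_nonneg.isSelfAdjoint.star_eq
  simp only [diffQuot, Pi.star_apply, map_star, star_mul, star_sub, hsa, mul_assoc]

theorem lipESeminorm_star (f : ∀ x, A x) : lipESeminorm D (star f) = lipESeminorm D f := by
  have h : ∀ x x', ‖diffQuot D (star f) x x'‖ₑ = ‖diffQuot D f x x'‖ₑ := fun x x' => by
    rw [star_diffQuot, ← ofReal_norm, ← ofReal_norm, norm_star]
  simp only [lipESeminorm, h]

theorem lipSeminorm_star (f : ∀ x, A x) : lipSeminorm D (star f) = lipSeminorm D f := by
  rw [lipSeminorm, lipESeminorm_star, lipSeminorm]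

theorem supNorm_star (f : ∀ x, A x) : supNorm (star f) = supNorm f := by
  simp only [supNorm, Pi.star_apply, norm_star]

theorem star_mem_L (hf : f ∈ L D) : star f ∈ L D := by
  refine ⟨mem_ellInfty_of_norm_le (C := supNorm f) fun x => ?_, (lipESeminorm_star f).trans_lt hf.2⟩
  rw [Pi.star_apply, norm_star]
  exact norm_le_supNorm hf.1 x

end Norms


/-! ### Consequences of the axioms of a metric operator field -/

section Mof

open SpatialTensor

/-- In leg notation the hypothesis is `K₁₂ + K₂₃ = K₁₃`. Flipping the first two legs fixes `K₁₂` and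
exchanges the other two terms, so `K₁₂ + K₁₃ = K₂₃`. Adding the two relations gives `2 K₁₂ = 0`, and
`K ↦ K₁₂` is injective. -/
theorem eq_zero_of_onLeft_add_onRight {A : Type u} [CStarAlgebra A] (ν : State A)
    {K : SpatialTensor A A} (hflip : flip K = K)
    (h : onLeft A A A K + onRight A A A K = middle A A A K) : K = 0 := by
  have hl : SpatialTensor.map flip (StarAlgHom.id ℂ A) (onLeft A A A K) = onLeft A A A K := by
    refine (map_tmul flip (StarAlgHom.id ℂ A) K 1).trans ?_
    rw [hflip]
    rfl
  have hr : SpatialTensor.map flip (StarAlgHom.id ℂ A) (onRight A A A K) = middle A A A K := by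
    refine DFunLike.congr_fun (starAlgHom_ext
      (φ := (SpatialTensor.map flip (StarAlgHom.id ℂ A)).comp (onRight A A A))
      (ψ := middle A A A) fun a b => ?_) K
    refine (congrArg (SpatialTensor.map flip (StarAlgHom.id ℂ A)) (map_tmul inr _ a b)).trans ?_
    refine (map_tmul flip _ _ _).trans (Eq.trans ?_ (map_tmul inl _ a b).symm)
    exact congrArg (fun s => tmul s b) (flip_tmul 1 a)
  have hm : SpatialTensor.map flip (StarAlgHom.id ℂ A) (middle A A A K) = onRight A A A K := by
    refine DFunLike.congr_fun (starAlgHom_ext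
      (φ := (SpatialTensor.map flip (StarAlgHom.id ℂ A)).comp (middle A A A))
      (ψ := onRight A A A) fun a b => ?_) K
    refine (congrArg (SpatialTensor.map flip (StarAlgHom.id ℂ A)) (map_tmul inl _ a b)).trans ?_
    refine (map_tmul flip _ _ _).trans (Eq.trans ?_ (map_tmul inr _ a b).symm)
    exact congrArg (fun s => tmul s b) (flip_tmul a 1)
  have h2 := congrArg (SpatialTensor.map flip (StarAlgHom.id ℂ A)) h
  rw [map_add, hl, hr, hm, ← h] at h2
  have h3 : (2 : ℂ) • onLeft A A A K = 0 := by
    rw [two_smul]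
    exact add_right_cancel (((add_assoc _ _ _).trans h2).trans (zero_add _).symm)
  have h4 : onLeft A A A K = 0 := (smul_eq_zero.mp h3).resolve_left two_ne_zero
  exact (injective_iff_map_eq_zero (onLeft A A A)).mp (inl_injective ν) K h4

variable {X : Type v} {A : X → Type u} [∀ x, CStarAlgebra (A x)]
  {D : ∀ x x' : X, SpatialTensor (A x) (A x')} {f g : ∀ x, A x}

theorem IsMof.state (hD : IsMof D) (x : X) : Nonempty (State (A x)) :=
  let ⟨μ, _⟩ := hD.exists_metricStates
  ⟨μ x⟩

theorem IsMof.isStrictlyPositive (hD : IsMof D) {x x' : X} (h : x ≠ x') :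
    IsStrictlyPositive (D x x') :=
  (hD.isUnit x x' h).isStrictlyPositive (hD.nonneg x x' h)

/-- The triangle inequality at `x, x, x` makes `D₁₂ + D₂₃ - D₁₃` positive, hence self-adjoint. So `K
= star D - D`, which is flip-invariant, satisfies `K₁₂ + K₂₃ = K₁₃` and vanishes. -/
theorem IsMof.isSelfAdjoint_diag (hD : IsMof D) (x : X) : IsSelfAdjoint (D x x) := by
  obtain ⟨ν⟩ := hD.state x
  have h1 : IsSelfAdjoint (onLeft (A x) (A x) (A x) (D x x) + onRight (A x) (A x) (A x) (D x x)
      - middle (A x) (A x) (A x) (D x x)) :=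
    (sub_nonneg.mpr (hD.triangle x x x)).isSelfAdjoint
  have h2 := h1.star_eq
  rw [star_sub, star_add, ← map_star, ← map_star, ← map_star] at h2
  refine sub_eq_zero.mp (eq_zero_of_onLeft_add_onRight ν ?_ ?_)
  · rw [map_sub, map_star, ← hD.symm x x]
  · rw [map_sub, map_sub, map_sub, ← sub_eq_zero]
    rw [← sub_eq_zero] at h2
    rw [← h2]
    abel

theorem IsMof.isSelfAdjoint (hD : IsMof D) (x x' : X) : IsSelfAdjoint (D x x') := by
  by_cases h : x = x'
  · subst h
    exact hD.isSelfAdjoint_diag x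
  · exact (hD.nonneg x x' h).isSelfAdjoint

theorem IsMof.norm_diffQuot_le (hD : IsMof D) (f : ∀ x, A x) {x x' : X} (h : x ≠ x') :
    ‖diffQuot D f x x'‖ ≤ ‖Ring.inverse (D x x')‖ * (‖f x‖ + ‖f x'‖) :=
  (norm_rpow_neg_half_conj_le (hD.isStrictlyPositive h) _).trans
    (mul_le_mul_of_nonneg_left ((norm_sub_le _ _).trans
      (add_le_add (norm_inl_le _) (norm_inr_le _))) (norm_nonneg _))

/-- Since `f x₀ = 0`, the difference at `(x, x₀)` is just `f x ⊗ 1`, whose norm is `‖f x‖`; removing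
the factors `D^{-1/2}` costs `‖D x x₀‖`. -/
theorem IsMof.norm_eval_le (hD : IsMof D) {x₀ : X} (hf : f ∈ L₀ D x₀) (x : X) :
    ‖f x‖ ≤ ‖D x x₀‖ * lipSeminorm D f := by
  have hf0 : f x₀ = 0 := hf.2
  by_cases h : x = x₀
  · rw [h, hf0, norm_zero]
    exact mul_nonneg (norm_nonneg _) (lipSeminorm_nonneg D f)
  · obtain ⟨ν⟩ := hD.state x₀
    calc ‖f x‖ = ‖(inl (f x) - inr (f x₀) : SpatialTensor (A x) (A x₀))‖ := by
          rw [hf0, map_zero, sub_zero, norm_inl ν]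
      _ ≤ ‖D x x₀‖ * ‖diffQuot D f x x₀‖ :=
          norm_le_norm_rpow_neg_half_conj (hD.isStrictlyPositive h) _
      _ ≤ _ := mul_le_mul_of_nonneg_left (norm_diffQuot_le_lipSeminorm hf.1 h) (norm_nonneg _)

open Filter Topology in
theorem IsMof.isBanachSpace_L₀_inf (hD : IsMof D) (x₀ : X) {W : Submodule ℂ (∀ x, A x)}
    (hW : IsClosed (W : Set (∀ x, A x))) : IsBanachSpace (L₀ D x₀ ⊓ W) (lipSeminorm D) := by
  refine isBanachSpace_inf_of_pointwise hW (fun c f _ => lipSeminorm_smul D c f)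
    (fun f hf g hg => lipSeminorm_add_le hf.1 hg.1) (fun f _ => lipSeminorm_nonneg D f)
    (fun x => ⟨‖D x x₀‖, fun f hf => hD.norm_eval_le hf x⟩) fun u f C hu hC hlim => ?_
  have hq : ∀ x x', x ≠ x' → ‖diffQuot D f x x'‖ ≤ C := fun x x' h =>
    le_of_tendsto' (((continuous_diffQuot D x x').tendsto f).comp hlim).norm fun n =>
      (norm_diffQuot_le_lipSeminorm (hu n).1 h).trans (hC n)
  refine ⟨⟨mem_lipschitzFields hq, ?_⟩, lipSeminorm_le ((lipSeminorm_nonneg D _).trans (hC 0)) hq⟩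
  refine tendsto_nhds_unique (tendsto_pi_nhds.mp hlim x₀) ?_
  exact tendsto_const_nhds.congr fun n => ((hu n).2 : u n x₀ = 0).symm

/-! ### The Lipschitz algebra -/

/-- Commutation is required only on the first leg; the flip symmetry of `D` transfers it to the
second. -/
theorem IsMof.commute_inr (hD : IsMof D) (hf : f ∈ commutingFields D) (x x' : X) :
    Commute (D x x') (inr (f x')) := by
  rw [hD.symm x x', ← flip_inl]
  exact (hf x' x).map SpatialTensor.flip

theorem commute_rpow_inl (hf : f ∈ commutingFields D) (x x' : X) (r : ℝ) :
    Commute (D x x' ^ r) (inl (f x)) := (hf x x').cfc_nnreal _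

theorem IsMof.commute_rpow_inr (hD : IsMof D) (hf : f ∈ commutingFields D) (x x' : X) (r : ℝ) :
    Commute (D x x' ^ r) (inr (f x')) := (hD.commute_inr hf x x').cfc_nnreal _

/-- Leibniz rule: insert `f(x) ⊗ g(x')` into the difference of products, then move `f(x) ⊗ 1` out to
the left and `1 ⊗ g(x')` out to the right past `D^{-1/2}`. -/
theorem IsMof.diffQuot_mul (hD : IsMof D) (hf : f ∈ commutingFields D)
    (hg : g ∈ commutingFields D) (x x' : X) :
    diffQuot D (f * g) x x' = inl (f x) * diffQuot D g x x' + diffQuot D f x x' * inr (g x') := by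
  have h1 := (commute_rpow_inl hf x x' (-(1 / 2))).eq
  have h2 := (hD.commute_rpow_inr hg x x' (-(1 / 2))).eq
  simp only [diffQuot, Pi.mul_apply, map_mul]
  generalize D x x' ^ (-(1 / 2) : ℝ) = d at h1 h2 ⊢
  calc d * (inl (f x) * inl (g x) - inr (f x') * inr (g x')) * d
      = (d * inl (f x)) * (inl (g x) - inr (g x')) * d
        + d * (inl (f x) - inr (f x')) * (inr (g x') * d) := by noncomm_ring
    _ = _ := by rw [h1, ← h2]; noncomm_ring

theorem IsMof.norm_diffQuot_mul_le (hD : IsMof D) (hf : f ∈ Lip D) (hg : g ∈ Lip D) {x x' : X}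
    (h : x ≠ x') : ‖diffQuot D (f * g) x x'‖ ≤
      supNorm f * lipSeminorm D g + lipSeminorm D f * supNorm g := by
  rw [hD.diffQuot_mul hf.2 hg.2]
  refine (norm_add_le _ _).trans (add_le_add ?_ ?_)
  · exact (norm_mul_le _ _).trans (mul_le_mul ((norm_inl_le _).trans (norm_le_supNorm hf.1.1 x))
      (norm_diffQuot_le_lipSeminorm hg.1.2 h) (norm_nonneg _) (supNorm_nonneg f))
  · exact (norm_mul_le _ _).trans (mul_le_mul (norm_diffQuot_le_lipSeminorm hf.1.2 h)
      ((norm_inr_le _).trans (norm_le_supNorm hg.1.1 x')) (norm_nonneg _)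
      (lipSeminorm_nonneg D f))

theorem IsMof.mul_mem_Lip (hD : IsMof D) (hf : f ∈ Lip D) (hg : g ∈ Lip D) : f * g ∈ Lip D := by
  refine ⟨⟨mul_mem_ellInfty hf.1.1 hg.1.1,
    mem_lipschitzFields fun x x' h => hD.norm_diffQuot_mul_le hf hg h⟩, fun x x' => ?_⟩
  rw [Pi.mul_apply, map_mul]
  exact (hf.2 x x').mul_right (hg.2 x x')

theorem IsMof.lipNorm_mul_le (hD : IsMof D) (hf : f ∈ Lip D) (hg : g ∈ Lip D) :
    lipNorm D (f * g) ≤ lipNorm D f * lipNorm D g := by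
  have hf0 := supNorm_nonneg f
  have hg0 := supNorm_nonneg g
  have hf1 := lipSeminorm_nonneg D f
  have hg1 := lipSeminorm_nonneg D g
  have h1 := supNorm_mul_le hf.1.1 hg.1.1
  have h2 : lipSeminorm D (f * g) ≤ supNorm f * lipSeminorm D g + lipSeminorm D f * supNorm g :=
    lipSeminorm_le (by positivity) fun x x' h => hD.norm_diffQuot_mul_le hf hg h
  -- The product of the two seminorms is the one term of `lipNorm D f * lipNorm D g` that the
  -- Leibniz estimate leaves over.
  have h3 := mul_nonneg hf1 hg1
  simp only [lipNorm]
  linarith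

theorem one_mem_Lip (D : ∀ x x' : X, SpatialTensor (A x) (A x')) : (1 : ∀ x, A x) ∈ Lip D := by
  refine ⟨⟨mem_ellInfty_of_norm_le (C := 1) fun x => ?_, mem_lipschitzFields (C := 0) fun x x' _ => ?_⟩, fun x x' => ?_⟩
  · rcases subsingleton_or_nontrivial (A x) with h | h
    · rw [Subsingleton.elim ((1 : ∀ x, A x) x) 0, norm_zero]
      exact zero_le_one
    · exact CStarRing.norm_one.le
  · simp [diffQuot]
  · rw [Pi.one_apply, map_one]
    exact Commute.one_right _

theorem IsMof.star_mem_Lip (hD : IsMof D) (hf : f ∈ Lip D) : star f ∈ Lip D := by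
  refine ⟨star_mem_L hf.1, fun x x' => ?_⟩
  have h := (hf.2 x x').star_star
  rwa [(hD.isSelfAdjoint x x').star_eq, ← map_star] at h

theorem IsMof.isBanachStarAlgebra_Lip (hD : IsMof D) : IsBanachStarAlgebra (Lip D) (lipNorm D) where
  toIsBanachSpace := isBanachSpace_L_inf (isClosed_commutingFields D)
  one_mem := one_mem_Lip D
  mul_mem f hf g hg := hD.mul_mem_Lip hf hg
  star_mem f hf := hD.star_mem_Lip hf
  norm_mul_le f hf g hg := hD.lipNorm_mul_le hf hg
  norm_star f _ := by rw [lipNorm, supNorm_star, lipSeminorm_star, lipNorm]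

theorem mem_Lip₀_inf_iff {x₀ : X} : f ∈ Lip₀ D x₀ ⊓ ellInfty A ↔ f ∈ Lip D ∧ f x₀ = 0 :=
  ⟨fun h => ⟨⟨⟨h.2, h.1.1.1⟩, h.1.2⟩, h.1.1.2⟩, fun h => ⟨⟨⟨h.1.1.2, h.2⟩, h.1.2⟩, h.1.1.1⟩⟩

theorem IsMof.isClosedIdeal_Lip₀ (hD : IsMof D) (x₀ : X) :
    IsClosedIdeal (Lip₀ D x₀ ⊓ ellInfty A) (Lip D) (lipNorm D) where
  le f hf := (mem_Lip₀_inf_iff.mp hf).1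
  mul_mem_left f hf g hg := by
    obtain ⟨hg, hg0⟩ := mem_Lip₀_inf_iff.mp hg
    exact mem_Lip₀_inf_iff.mpr ⟨hD.mul_mem_Lip hf hg, by rw [Pi.mul_apply, hg0, mul_zero]⟩
  mul_mem_right f hf g hg := by
    obtain ⟨hg, hg0⟩ := mem_Lip₀_inf_iff.mp hg
    exact mem_Lip₀_inf_iff.mpr ⟨hD.mul_mem_Lip hg hf, by rw [Pi.mul_apply, hg0, zero_mul]⟩
  closed f hf h := by
    -- Evaluation at `x₀` is contractive for `lipNorm`, so vanishing there survives limits.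
    refine mem_Lip₀_inf_iff.mpr ⟨hf, norm_le_zero_iff.mp (le_of_forall_pos_le_add fun ε hε => ?_)⟩
    obtain ⟨g, hg, hfg⟩ := h ε hε
    obtain ⟨hg, hg0⟩ := mem_Lip₀_inf_iff.mp hg
    have h1 := norm_le_supNorm ((Lip D).sub_mem hf hg).1.1 x₀
    rw [Pi.sub_apply, hg0, sub_zero] at h1
    linarith [supNorm_le_lipNorm D (f - g)]

/-! ### Bounded metric operator fields and bounded inverses -/

theorem IsMof.L₀_le_L (hD : IsMof D) (h : IsBoundedMof D) (x₀ : X) : L₀ D x₀ ≤ L D := fun f hf => by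
  obtain ⟨M, hM⟩ := h
  exact ⟨mem_ellInfty_of_norm_le fun x => (hD.norm_eval_le hf x).trans
    (mul_le_mul_of_nonneg_right (hM x x₀) (lipSeminorm_nonneg D f)), hf.1⟩

theorem IsMof.exists_norm_diffQuot_le (hD : IsMof D) (h : IsInvBoundedOffDiag D) :
    ∃ M, 0 ≤ M ∧ ∀ f ∈ ellInfty A, ∀ x x', x ≠ x' → ‖diffQuot D f x x'‖ ≤ M * supNorm f := by
  obtain ⟨M, hM⟩ := h
  -- The factor 2 accounts for the two legs; `|M|` is used because `M` may be negative when `X` has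
  -- no two distinct points.
  refine ⟨2 * |M|, by positivity, fun f hf x x' hx => (hD.norm_diffQuot_le f hx).trans ?_⟩
  have h1 := mul_le_mul ((hM x x' hx).trans (le_abs_self M))
    (add_le_add (norm_le_supNorm hf x) (norm_le_supNorm hf x')) (by positivity) (abs_nonneg M)
  linarith

theorem IsMof.L_eq_ellInfty (hD : IsMof D) (h : IsInvBoundedOffDiag D) : L D = ellInfty A := by
  obtain ⟨M, -, hM⟩ := hD.exists_norm_diffQuot_le h
  exact le_antisymm inf_le_left fun f hf => ⟨hf, mem_lipschitzFields (hM f hf)⟩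

theorem IsMof.exists_lipNorm_le (hD : IsMof D) (h : IsInvBoundedOffDiag D) :
    ∃ M, 0 < M ∧ ∀ f ∈ ellInfty A, lipNorm D f ≤ M * supNorm f := by
  obtain ⟨M, hM0, hM⟩ := hD.exists_norm_diffQuot_le h
  refine ⟨M + 1, by positivity, fun f hf => ?_⟩
  have h1 := lipSeminorm_le (mul_nonneg hM0 (supNorm_nonneg f)) (hM f hf)
  rw [lipNorm]
  linarith

/-- The norm lies between the supremum norm and a multiple of it, and multiplication is continuous
for the supremum norm. -/
theorem IsMof.continuousMulOn_L (hD : IsMof D) (h : IsInvBoundedOffDiag D) :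
    ContinuousMulOn (L D) (lipNorm D) := by
  obtain ⟨M, hM0, hM⟩ := hD.exists_lipNorm_le h
  rw [hD.L_eq_ellInfty h]
  refine ⟨fun f hf g hg => mul_mem_ellInfty hf hg, fun f hf g hg ε hε => ?_⟩
  have hf0 := supNorm_nonneg f
  have hg0 := supNorm_nonneg g
  set K := M * (supNorm f + supNorm g + 1) with hK
  have hK0 : 0 < K := by positivity
  -- The bound by 1 makes the quadratic term `(f' - f) * (g' - g)` linear in `δ`; this is the `+ 1`
  -- in `K`.
  refine ⟨min 1 (ε / K), lt_min one_pos (by positivity), fun f' hf' g' hg' hff hgg => ?_⟩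
  have hdf := (ellInfty A).sub_mem hf' hf
  have hdg := (ellInfty A).sub_mem hg' hg
  have hf1 : supNorm (f' - f) < min 1 (ε / K) := (supNorm_le_lipNorm D _).trans_lt hff
  have hg1 : supNorm (g' - g) < min 1 (ε / K) := (supNorm_le_lipNorm D _).trans_lt hgg
  have hf2 := supNorm_nonneg (f' - f)
  set δ := min 1 (ε / K) with hδ
  have hδ1 : δ ≤ 1 := min_le_left _ _
  have hδ0 : 0 < δ := hf2.trans_lt hf1
  have heq : f' * g' - f * g = ((f' - f) * (g' - g) + f * (g' - g)) + (f' - f) * g := by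
    noncomm_ring
  have h1 : supNorm (f' * g' - f * g) ≤ supNorm (f' - f) * supNorm (g' - g)
      + supNorm f * supNorm (g' - g) + supNorm (f' - f) * supNorm g := by
    rw [heq]
    have m1 := mul_mem_ellInfty hdf hdg
    have m2 := mul_mem_ellInfty hf hdg
    have m3 := mul_mem_ellInfty hdf hg
    exact (supNorm_add_le ((ellInfty A).add_mem m1 m2) m3).trans (add_le_add
      ((supNorm_add_le m1 m2).trans (add_le_add (supNorm_mul_le hdf hdg) (supNorm_mul_le hf hdg)))
      (supNorm_mul_le hdf hg))
  have h2 : supNorm (f' * g' - f * g) < δ * (supNorm f + supNorm g + 1) := by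
    have a1 : supNorm (f' - f) * supNorm (g' - g) < δ := by
      calc supNorm (f' - f) * supNorm (g' - g) ≤ supNorm (f' - f) * 1 :=
            mul_le_mul_of_nonneg_left (hg1.le.trans hδ1) hf2
        _ < δ := by rwa [mul_one]
    have a2 := mul_le_mul_of_nonneg_left hg1.le hf0
    have a3 := mul_le_mul_of_nonneg_right hf1.le hg0
    linarith
  calc lipNorm D (f' * g' - f * g) ≤ M * supNorm (f' * g' - f * g) :=
        hM _ ((ellInfty A).sub_mem (mul_mem_ellInfty hf' hg') (mul_mem_ellInfty hf hg))
    _ < M * (δ * (supNorm f + supNorm g + 1)) := mul_lt_mul_of_pos_left h2 hM0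
    _ = δ * K := by rw [hK]; ring
    _ ≤ ε / K * K := mul_le_mul_of_nonneg_right (min_le_right _ _) hK0.le
    _ = ε := div_mul_cancel₀ _ hK0.ne'

/-! ### The metric given by the norms of `D` -/

theorem normDist_self (D : ∀ x x' : X, SpatialTensor (A x) (A x')) (x : X) :
    normDist D x x = 0 := if_pos rfl

theorem normDist_of_ne (D : ∀ x x' : X, SpatialTensor (A x) (A x')) {x x' : X} (h : x ≠ x') :
    normDist D x x' = ‖D x x'‖ := if_neg h

theorem normDist_nonneg (D : ∀ x x' : X, SpatialTensor (A x) (A x')) (x x' : X) :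
    0 ≤ normDist D x x' := by
  by_cases h : x = x'
  · rw [h, normDist_self]
  · rw [normDist_of_ne D h]
    exact norm_nonneg _

theorem IsMof.normDist_comm (hD : IsMof D) (x x' : X) : normDist D x x' = normDist D x' x := by
  by_cases h : x = x'
  · rw [h]
  · rw [normDist_of_ne D h, normDist_of_ne D (Ne.symm h), hD.symm x x', norm_flip]

theorem IsMof.normDist_triangle (hD : IsMof D) (x x' x'' : X) :
    normDist D x x'' ≤ normDist D x x' + normDist D x' x'' := by
  -- On the diagonal `normDist` is `0` by definition rather than `‖D x x‖`, so triples with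
  -- coinciding points are treated apart from the operator inequality.
  by_cases h : x = x''
  · rw [h, normDist_self]
    exact add_nonneg (normDist_nonneg D _ _) (normDist_nonneg D _ _)
  by_cases h1 : x = x'
  · rw [h1, normDist_self, zero_add]
  by_cases h2 : x' = x''
  · rw [h2, normDist_self, add_zero]
  rw [normDist_of_ne D h, normDist_of_ne D h1, normDist_of_ne D h2]
  obtain ⟨ν⟩ := hD.state x'
  have hpos : 0 ≤ middle (A x) (A x') (A x'') (D x x'') := map_nonneg _ (hD.nonneg x x'' h)
  calc ‖D x x''‖ = ‖middle (A x) (A x') (A x'') (D x x'')‖ := (norm_middle ν _).symm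
    _ ≤ ‖onLeft (A x) (A x') (A x'') (D x x') + onRight (A x) (A x') (A x'') (D x' x'')‖ :=
      CStarAlgebra.norm_le_norm_of_nonneg_of_le hpos (hD.triangle x x' x'')
    _ ≤ _ := (norm_add_le _ _).trans (add_le_add
      (NonUnitalStarAlgHom.norm_apply_le (onLeft (A x) (A x') (A x'')) _)
      (NonUnitalStarAlgHom.norm_apply_le (onRight (A x) (A x') (A x'')) _))

/-- This makes `normDist` positive off the diagonal and, when the inverses are bounded, bounded away
from zero; the latter gives discreteness. -/
theorem IsMof.one_le_norm_mul (hD : IsMof D) {x x' : X} (h : x ≠ x') :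
    1 ≤ ‖D x x'‖ * ‖Ring.inverse (D x x')‖ := by
  obtain ⟨μ⟩ := hD.state x
  obtain ⟨ν⟩ := hD.state x'
  have _ := SpatialTensor.nontrivial μ ν
  calc (1 : ℝ) = ‖(1 : SpatialTensor (A x) (A x'))‖ := CStarRing.norm_one.symm
    _ = ‖D x x' * Ring.inverse (D x x')‖ := by rw [Ring.mul_inverse_cancel _ (hD.isUnit x x' h)]
    _ ≤ _ := norm_mul_le _ _

/-- The metric `D^{‖·‖}` of a metric operator field. -/
abbrev IsMof.metricSpace (hD : IsMof D) : MetricSpace X where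
  dist := normDist D
  dist_self := normDist_self D
  dist_comm := hD.normDist_comm
  dist_triangle := hD.normDist_triangle
  eq_of_dist_eq_zero {x x'} h := by
    by_contra hne
    have h1 := hD.one_le_norm_mul hne
    change normDist D x x' = 0 at h
    rw [← normDist_of_ne D hne, h, zero_mul] at h1
    exact absurd h1 (by norm_num)

theorem IsMof.discreteTopology (hD : IsMof D) (h : IsInvBoundedOffDiag D) :
    @DiscreteTopology X hD.metricSpace.toPseudoMetricSpace.toUniformSpace.toTopologicalSpace := by
  let _ := hD.metricSpace
  obtain ⟨M, hM⟩ := h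
  refine DiscreteTopology.of_forall_le_dist (r := (|M| + 1)⁻¹) (by positivity) fun x x' hne => ?_
  change _ ≤ normDist D x x'
  rw [normDist_of_ne D hne, inv_le_iff_one_le_mul₀ (by positivity)]
  exact (hD.one_le_norm_mul hne).trans (mul_le_mul_of_nonneg_left
    ((hM x x' hne).trans (by linarith [le_abs_self M])) (norm_nonneg _))

/-! ### Central metric operator fields -/

theorem IsCentral.commutingFields_eq_top (h : IsCentral D) : commutingFields D = ⊤ := by
  refine eq_top_iff.mpr fun f _ x x' => ?_
  -- The commutant of `f x ⊗ 1` is closed, so it suffices to check the span of elementary tensors of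
  -- central elements.
  have hcl : IsClosed {t : SpatialTensor (A x) (A x') | t * inl (f x) = inl (f x) * t} :=
    isClosed_eq (continuous_id.mul continuous_const) (continuous_const.mul continuous_id)
  refine closure_minimal (fun t ht => ?_) hcl (h x x')
  change Commute t (inl (f x))
  induction ht using Submodule.span_induction with
  | mem t ht =>
    obtain ⟨a, ha, b, hb, rfl⟩ := ht
    rw [← inl_mul_inr]
    exact Commute.mul_left ((Set.mem_center_iff.mp ha).comm (f x) |>.map inl)
      (commute_inl_inr (f x) b).symm
  | zero => exact Commute.zero_left _
  | add s t _ _ hs ht => exact hs.add_left ht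
  | smul c t _ ht => exact ht.smul_left c

end Mof

end MOF

end

theorem mainTheorem5 {X : Type*} (A : X → Type*) [∀ x, CStarAlgebra (A x)]
    (D : ∀ x x' : X, MOF.SpatialTensor (A x) (A x')) (hD : MOF.IsMof D) :
    MOF.IsBanachSpace (MOF.L D) (MOF.lipNorm D) ∧
    MOF.IsBanachStarAlgebra (MOF.Lip D) (MOF.lipNorm D) ∧
    (∀ x₀ : X, MOF.IsClosedIdeal (MOF.Lip₀ D x₀ ⊓ MOF.ellInfty A) (MOF.Lip D) (MOF.lipNorm D)) ∧
    (∀ x₀ : X, MOF.IsBanachSpace (MOF.L₀ D x₀) (MOF.lipSeminorm D)) ∧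
    (∀ x₀ : X, MOF.IsBanachSpace (MOF.Lip₀ D x₀) (MOF.lipSeminorm D)) ∧
    (MOF.IsBoundedMof D → ∀ x₀ : X, MOF.L₀ D x₀ ≤ MOF.L D) ∧
    (MOF.IsInvBoundedOffDiag D →
      MOF.L D = MOF.ellInfty A ∧
      ∃ m : MetricSpace X, (∀ x x', m.dist x x' = MOF.normDist D x x') ∧
        @DiscreteTopology X m.toPseudoMetricSpace.toUniformSpace.toTopologicalSpace) ∧
    (MOF.IsBoundedOffDiag D → MOF.IsInvBoundedOffDiag D →
      MOF.L D = MOF.ellInfty A ∧ MOF.ContinuousMulOn (MOF.L D) (MOF.lipNorm D)) ∧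
    (MOF.IsCentral D → (∀ x₀ : X, MOF.L₀ D x₀ = MOF.Lip₀ D x₀) ∧ MOF.L D = MOF.Lip D) := by
  refine ⟨?_, hD.isBanachStarAlgebra_Lip, hD.isClosedIdeal_Lip₀, fun x₀ => ?_,
    fun x₀ => hD.isBanachSpace_L₀_inf x₀ (MOF.isClosed_commutingFields D), hD.L₀_le_L,
    fun h => ⟨hD.L_eq_ellInfty h, hD.metricSpace, fun _ _ => rfl, hD.discreteTopology h⟩,
    fun _ h => ⟨hD.L_eq_ellInfty h, hD.continuousMulOn_L h⟩, fun h => ⟨fun x₀ => ?_, ?_⟩⟩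
  -- The spaces without the commutation condition are the case `W = ⊤` of the completeness results.
  · rw [← inf_top_eq (MOF.L D)]
    exact MOF.isBanachSpace_L_inf isClosed_univ
  · rw [← inf_top_eq (MOF.L₀ D x₀)]
    exact hD.isBanachSpace_L₀_inf x₀ isClosed_univ
  · rw [MOF.Lip₀, h.commutingFields_eq_top, inf_top_eq]
  · rw [MOF.Lip, h.commutingFields_eq_top, inf_top_eq]
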